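/- Let $f(u)=u^3-u$ and $U(x)=\tanh(x/\sqrt2)$, the increasing solution of $U''=f(U)$, $U(0)=0$, $U(\pm\infty)=\pm1$, and let $\lambda_0=\tfrac32$, the spectral gap of $y\mapsto y''-f'(U)y$ on $L^2(\mathbb R)$. Fix an integer $N\ge 0$, $\kappa\in(0,1)$ and $m>0$, and put $\rho_\varepsilon=\varepsilon^{\kappa}$. Let $$\Omega_{\rho_\varepsilon}=\Big\{h\in\mathbb R^{N+1}:\ 0<h_1<\dots<h_{N+1}<1,\ \min_{0\le j\le N+1}(h_{j+1}-h_j)>\varepsilon/\rho_\varepsilon\Big\},\qquad h_0:=-h_1,\quad h_{N+2}:=2-h_{N+1},$$ and for $h\in\Omega_{\rho_\varepsilon}$, $x\in[0,1]$ let $$u^h(x)=\sum_{j=1}^{N+1}(-1)^{j+1}\,U\!\Big(\frac{x-h_j}{\varepsilon}\Big)+\beta(x),\qquad u^h_i=\partial_{h_i}u^h,$$ where $\beta=\beta_{\varepsilon,h}$ is any normalization function that, for all small $\varepsilon$, is smooth in $(h,x)\in\Omega_{\rho_\varepsilon}\times[0,1]$ and satisfies $\beta=\tfrac{(-1)^N-1}{2}+O(\exp)$,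 together with all its derivatives in $(h,x)$; here $O(\exp)$ means, for each order of derivative, a bound $C e^{-c/\rho_\varepsilon}$ for all small $\varepsilon$, with constants $C,c>0$ not depending on $\varepsilon,h,x$. Let $\langle\cdot,\cdot\rangle$ and $\|\cdot\|$ be the inner product and norm of $L^2(0,1)$, and $$\mathcal L^h v=\varepsilon^2v_{xx}-f'(u^h)v,\qquad \mathcal N^h(v)=f(u^h)-f(u^h+v)+f'(u^h)v,$$ with Neumann boundary conditions $v_x(0)=v_x(1)=0$; for $v\in H^1(0,1)$ the expression $\langle\mathcal L^hv,v\rangle$ denotes the quadratic form $\int_0^1\big(-\varepsilon^2v_x^2-f'(u^h)v^2\big)\,dx$. Then there is $\varepsilon_0>0$, depending only on $N$, $\kappa$, $m$ and the family $\beta$, such that for all $0<\varepsilon<\varepsilon_0$, all $h\in\Omega_{\rho_\varepsilon}$ and all $v\in H^1(0,1)$ with $\langle v,u^h_i\rangle=0$ for $i=1,\dots,N+1$ and $\|v\|<\varepsilon^{1/2+m}$, $$\langle\mathcal L^hv,v\rangle+\langle\mathcal N^h(v),v\rangle\le-\tfrac12\lambda_0\|v\|^2 .$$ In particular, if moreover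 $v\in H^2(0,1)$ and $v_x(0)=v_x(1)=0$, then $\langle\mathcal L^hv+\mathcal N^h(v),v\rangle\le-\tfrac12\lambda_0\|v\|^2$ with the $L^2(0,1)$ inner product of functions. -/

import Mathlib

open Set Filter Topology MeasureTheory
open scoped ContDiff

namespace AllenCahn

noncomputable section

/-- The nonlinearity `f = F'` of the standard double well `F(u) = (1 - u²)² / 4`. -/
def f (u : ℝ) : ℝ := u ^ 3 - u

/-- The heteroclinic `U` joining `-1` to `+1`: `U'' = f(U)`, `U(0) = 0`, `U(±∞) = ±1`
(see `hasDerivAt_U`, `hasDerivAt_deriv_U`). -/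
def U (x : ℝ) : ℝ := Real.tanh (x / √2)

/-- The spectral gap `λ₀ = 3/2` of `y ↦ y'' - f'(U) y` on `ℝ`, orthogonally to `U'`, for the
cubic nonlinearity `f`. -/
def lambda0 : ℝ := 3 / 2

/-- The admissible interface positions `0 < h₁ < … < h_{N+1} < 1` whose consecutive distances
`h_{j+1} - h_j`, `j = 0, …, N + 1`, all exceed `ε / ρ_ε` with `ρ_ε = ε ^ κ`, where
`h₀ = -h₁` and `h_{N+2} = 2 - h_{N+1}`. The entry `h_{j+1}` is `h j`, `j : Fin (N + 1)`. -/
def admissible (N : ℕ) (κ ε : ℝ) : Set (Fin (N + 1) → ℝ) :=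
  {h | 0 < h 0 ∧ StrictMono h ∧ h (Fin.last N) < 1 ∧
    ε / ε ^ κ < h 0 - (-h 0) ∧
    (∀ j : Fin N, ε / ε ^ κ < h j.succ - h j.castSucc) ∧
    ε / ε ^ κ < (2 - h (Fin.last N)) - h (Fin.last N)}

/-- `β ε h x` is a normalization function: smooth in `(h, x)`, and equal to
`((-1)^N - 1) / 2` up to an error that is, together with each of its derivatives in `(h, x)`,
`O(exp(-c / ρ_ε))` as `ε → 0`, uniformly for admissible `h` and `x ∈ [0, 1]`.
It is not required that `β` be chosen so that the profile satisfies in addition `u(0) = -1` and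
the Neumann boundary conditions exactly; such choices are among the ones allowed here. -/
structure IsNormalization (N : ℕ) (κ : ℝ) (β : ℝ → (Fin (N + 1) → ℝ) → ℝ → ℝ) : Prop where
  smooth : ∀ᶠ ε in 𝓝[>] (0 : ℝ),
    ContDiffOn ℝ ∞ (fun p : (Fin (N + 1) → ℝ) × ℝ => β ε p.1 p.2)
      (admissible N κ ε ×ˢ Icc (0 : ℝ) 1)
  small : ∀ n : ℕ, ∃ C > 0, ∃ c > 0, ∀ᶠ ε in 𝓝[>] (0 : ℝ),
    ∀ p ∈ admissible N κ ε ×ˢ Icc (0 : ℝ) 1,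
      ‖iteratedFDerivWithin ℝ n
        (fun p : (Fin (N + 1) → ℝ) × ℝ => β ε p.1 p.2 - ((-1 : ℝ) ^ N - 1) / 2)
        (admissible N κ ε ×ˢ Icc (0 : ℝ) 1) p‖ ≤ C * Real.exp (-(c / ε ^ κ))

/-- The multi-kink profile
`u^h(x) = ∑_{j=1}^{N+1} (-1)^{j+1} U((x - h_j) / ε) + β(x)`
(the exponent is `j` in the zero-based indexing of `Fin (N + 1)`). -/
def profile {N : ℕ} (β : ℝ → (Fin (N + 1) → ℝ) → ℝ → ℝ) (ε : ℝ) (h : Fin (N + 1) → ℝ)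
    (x : ℝ) : ℝ :=
  ∑ j : Fin (N + 1), (-1 : ℝ) ^ (j : ℕ) * U ((x - h j) / ε) + β ε h x

/-- The tangent vector `u^h_i = ∂u^h / ∂h_i`. -/
def tangent {N : ℕ} (β : ℝ → (Fin (N + 1) → ℝ) → ℝ → ℝ) (ε : ℝ) (h : Fin (N + 1) → ℝ)
    (i : Fin (N + 1)) (x : ℝ) : ℝ :=
  deriv (fun s : ℝ => profile β ε (Function.update h i s) x) (h i)

/-- The inner product of `L²(0, 1)`. -/
def ip (v w : ℝ → ℝ) : ℝ := ∫ x in (0 : ℝ)..1, v x * w x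

/-- The norm of `L²(0, 1)`. -/
def l2norm (v : ℝ → ℝ) : ℝ := √(ip v v)

/-- `v ∈ H¹(0, 1)` (as its absolutely continuous representative on `[0, 1]`) with weak derivative
`v' ∈ L²(0, 1)`. -/
structure HasH1Deriv (v v' : ℝ → ℝ) : Prop where
  memLp : MemLp v' 2 (volume.restrict (Icc (0 : ℝ) 1))
  eq_integral : ∀ x ∈ Icc (0 : ℝ) 1, v x = v 0 + ∫ t in (0 : ℝ)..x, v' t

/-- `v ∈ H²(0, 1)` with weak derivatives `v'` (absolutely continuous representative) and `v''`,
satisfying the Neumann boundary conditions `v'(0) = v'(1) = 0`. -/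
structure HasH2NeumannDeriv (v v' v'' : ℝ → ℝ) : Prop where
  first : HasH1Deriv v v'
  second : HasH1Deriv v' v''
  left : v' 0 = 0
  right : v' 1 = 0

/-- The linearized operator `ε² v_xx - f'(u) v` at `u`, where `v''` is the second derivative
of `v`. -/
def linOp (ε : ℝ) (u v v'' : ℝ → ℝ) (x : ℝ) : ℝ := ε ^ 2 * v'' x - deriv f (u x) * v x

/-- The nonlinear remainder `f(u) - f(u + v) + f'(u) v` at `u`. -/
def nonlin (u v : ℝ → ℝ) (x : ℝ) : ℝ := f (u x) - f (u x + v x) + deriv f (u x) * v x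

/-- The quadratic form of the linearized Neumann operator on its form domain `H¹(0, 1)`,
where `v'` is the weak derivative of `v`:
`⟨ε² v_xx - f'(u) v, v⟩ = ∫₀¹ (-ε² v_x² - f'(u) v²)`. -/
def linForm (ε : ℝ) (u v v' : ℝ → ℝ) : ℝ :=
  ∫ x in (0 : ℝ)..1, (-(ε ^ 2 * v' x ^ 2) - deriv f (u x) * v x ^ 2)

theorem hasDerivAt_U (x : ℝ) : HasDerivAt U ((1 - U x ^ 2) / √2) x := by
  have h1 : HasDerivAt (fun x : ℝ => x / √2) (1 / √2) x := (hasDerivAt_id x).div_const _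
  have hc := (Real.cosh_pos (x / √2)).ne'
  have h2 : HasDerivAt (fun x : ℝ => Real.sinh (x / √2) / Real.cosh (x / √2)) _ x :=
    h1.sinh.div h1.cosh hc
  have h3 : U = fun x : ℝ => Real.sinh (x / √2) / Real.cosh (x / √2) := by
    funext y
    simp only [U, Real.tanh_eq_sinh_div_cosh]
  rw [h3]
  convert h2 using 1
  have := Real.cosh_sq (x / √2)
  field_simp

theorem hasDerivAt_deriv_U (x : ℝ) : HasDerivAt (deriv U) (f (U x)) x := by
  have h : deriv U = fun x => (1 - U x ^ 2) / √2 := funext fun y => (hasDerivAt_U y).deriv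
  rw [h]
  have h2 : (√2 : ℝ) ^ 2 = 2 := Real.sq_sqrt (by norm_num)
  have h3 := (((hasDerivAt_U x).fun_pow 2).const_sub 1).div_const (√2)
  refine h3.congr_deriv ?_
  simp only [f]
  field_simp
  rw [h2]
  push_cast
  ring

end

end AllenCahn

/-! The interval is cut at the midpoints between interfaces. On each cell the profile is plus or
minus one kink `k`, up to exponentially small errors, and `f'(±k) = 3k² - 1` does not see the sign.
The translation mode `φ = 1 - k²` satisfies `ε²φ'' = (3k² - 1)φ`.

On a cell with centre `h` the function `z = v - v(h)φ` vanishes at `h`, and for such functions `∫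
(ε²z'² + (3k² - 2)z²) ≥ 0` without any condition at the ends of the cell (`energy_nonneg_right`,
`energy_nonneg_left`). The reason is a positive supersolution `w = k exp(-k²/2)` on the right half
cell: its Riccati variable `P = ε²w'/w` is nonnegative, so a free end contributes with the good
sign. Expanding the square in `z` (`cell_estimate`) leaves the energy of `v` minus `∫ v²`, a
multiple of `∫ vφ`, which is small by orthogonality to the tangent vectors, boundary terms in which
`φ` is tiny, and `-v(h)²∫ φ²`, which may be dropped.

Summing over cells, the energy is at least `‖v‖²` minus an exponentially small multiple of `sup
|v|²` (`profile_energy_lower_bound`). The constant `1` is below `λ₀ = 3/2` but above the required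
`λ₀/2 = 3/4`. The surplus absorbs the errors and the cubic term, after `sup |v|²` is bounded by
`‖v‖²` and `‖v'‖²` with a weight tuned to `‖v‖ < ε^(1/2+m)` (`energy_estimate`). -/

namespace AllenCahn

/-! ### Absolutely continuous functions -/

/-- `v` is absolutely continuous on `[a, b]` with almost everywhere derivative `v'`. -/
structure HasACDeriv (v v' : ℝ → ℝ) (a b : ℝ) : Prop where
  ac : AbsolutelyContinuousOnInterval v a b
  ae_deriv : ∀ᵐ x, x ∈ uIcc a b → HasDerivAt v (v' x) x

namespace HasACDeriv

variable {v v' w w' : ℝ → ℝ} {a b c d : ℝ}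

theorem ae_deriv_eq (hv : HasACDeriv v v' a b) : ∀ᵐ x, x ∈ uIoc a b → deriv v x = v' x := by
  filter_upwards [hv.ae_deriv] with x hx hxI using (hx (uIoc_subset_uIcc hxI)).deriv

theorem integral_eq_sub (hv : HasACDeriv v v' a b) : ∫ x in a..b, v' x = v b - v a := by
  rw [← hv.ac.integral_deriv_eq_sub]
  refine intervalIntegral.integral_congr_ae ?_
  filter_upwards [hv.ae_deriv_eq] with x hx hxI using (hx hxI).symm

theorem intervalIntegrable (hv : HasACDeriv v v' a b) : IntervalIntegrable v' volume a b :=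
  hv.ac.intervalIntegrable_deriv.congr_ae
    ((ae_restrict_iff' measurableSet_uIoc).2 hv.ae_deriv_eq)

theorem continuousOn (hv : HasACDeriv v v' a b) : ContinuousOn v (uIcc a b) := hv.ac.continuousOn

theorem mono (hv : HasACDeriv v v' a b) (h : uIcc c d ⊆ uIcc a b) : HasACDeriv v v' c d := by
  refine ⟨hv.ac.mono h, ?_⟩
  filter_upwards [hv.ae_deriv] with x hx hxI using hx (h hxI)

theorem sub (hv : HasACDeriv v v' a b) (hw : HasACDeriv w w' a b) :
    HasACDeriv (fun x => v x - w x) (fun x => v' x - w' x) a b := by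
  refine ⟨hv.ac.sub hw.ac, ?_⟩
  filter_upwards [hv.ae_deriv, hw.ae_deriv] with x h1 h2 hx using (h1 hx).sub (h2 hx)

theorem mul (hv : HasACDeriv v v' a b) (hw : HasACDeriv w w' a b) :
    HasACDeriv (fun x => v x * w x) (fun x => v' x * w x + v x * w' x) a b := by
  refine ⟨hv.ac.fun_mul hw.ac, ?_⟩
  filter_upwards [hv.ae_deriv, hw.ae_deriv] with x h1 h2 hx using (h1 hx).mul (h2 hx)

theorem of_hasDerivAt (h : ∀ x ∈ uIcc a b, HasDerivAt v (v' x) x)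
    (hc : ContinuousOn v' (uIcc a b)) : HasACDeriv v v' a b := by
  refine ⟨?_, Eventually.of_forall h⟩
  obtain ⟨C, hC⟩ := isCompact_uIcc.exists_bound_of_continuousOn hc
  refine LipschitzOnWith.absolutelyContinuousOnInterval (K := C.toNNReal) ?_
  refine (convex_uIcc a b).lipschitzOnWith_of_nnnorm_hasDerivWithin_le
    (fun x hx => (h x hx).hasDerivWithinAt) fun x hx => ?_
  rw [← NNReal.coe_le_coe, coe_nnnorm]
  exact (hC x hx).trans (Real.le_coe_toNNReal C)

/-- The Cauchy–Schwarz bound for the increment of an absolutely continuous function. -/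
theorem sq_sub_le (hv : HasACDeriv v v' a b) (hab : a < b)
    (h2 : IntervalIntegrable (fun x => v' x ^ 2) volume a b) :
    (v b - v a) ^ 2 ≤ (b - a) * ∫ x in a..b, v' x ^ 2 := by
  -- With `t` the mean of `v'`, expanding `∫ (v' - t)² ≥ 0` is exactly the claim.
  set t := (v b - v a) / (b - a) with ht
  have hba : 0 < b - a := sub_pos.2 hab
  have h0 : 0 ≤ ∫ x in a..b, (v' x - t) ^ 2 :=
    intervalIntegral.integral_nonneg hab.le fun x _ => sq_nonneg _
  have h1 : ∫ x in a..b, (v' x - t) ^ 2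
      = (∫ x in a..b, v' x ^ 2) - 2 * t * (v b - v a) + (b - a) * t ^ 2 := by
    rw [← hv.integral_eq_sub, ← intervalIntegral.integral_const_mul,
      ← intervalIntegral.integral_sub h2 (hv.intervalIntegrable.const_mul _)]
    rw [← smul_eq_mul (b - a), ← intervalIntegral.integral_const,
      ← intervalIntegral.integral_add (h2.sub (hv.intervalIntegrable.const_mul _)) (by simp)]
    refine intervalIntegral.integral_congr fun x _ => ?_
    ring
  have h3 : t * (b - a) = v b - v a := div_mul_cancel₀ _ hba.ne'
  rw [h1, ← h3] at h0
  rw [← h3]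
  nlinarith

end HasACDeriv

theorem HasACDeriv.of_eq_integral {v v' : ℝ → ℝ} {a b : ℝ} (hab : a ≤ b)
    (hi : IntervalIntegrable v' volume a b)
    (heq : ∀ x ∈ uIcc a b, v x = v a + ∫ t in a..x, v' t) : HasACDeriv v v' a b := by
  have hac : AbsolutelyContinuousOnInterval (fun x => v a + ∫ t in a..x, v' t) a b :=
    AbsolutelyContinuousOnInterval.add
      (LipschitzOnWith.absolutelyContinuousOnInterval (LipschitzWith.const (v a)).lipschitzOnWith)
      (hi.absolutelyContinuousOnInterval_intervalIntegral (by simp))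
  refine ⟨?_, ?_⟩
  · rw [absolutelyContinuousOnInterval_iff] at hac ⊢
    intro r hr
    obtain ⟨δ, hδ, H⟩ := hac r hr
    refine ⟨δ, hδ, fun E hE hlt => ?_⟩
    convert H E hE hlt using 3 with i hi
    · exact heq _ (hE.1 i hi).1
    · exact heq _ (hE.1 i hi).2
  -- The endpoints are discarded because the integral formula is known only on `[a, b]`, which is a
  -- neighbourhood of interior points alone.
  · filter_upwards [hi.ae_hasDerivAt_integral, Measure.ae_ne volume a, Measure.ae_ne volume b]
      with x hx ha hb hxI
    have := (hx hxI a (by simp)).const_add (v a)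
    refine this.congr_of_eventuallyEq ?_
    rw [uIcc_of_le hab] at hxI heq
    filter_upwards [Ioo_mem_nhds (hxI.1.lt_of_ne ha.symm) (hxI.2.lt_of_ne hb)] with y hy
    exact heq y (Ioo_subset_Icc_self hy)

theorem HasACDeriv.reflect {v v' : ℝ → ℝ} {a h : ℝ} (hah : a ≤ h) (hv : HasACDeriv v v' a h) :
    HasACDeriv (fun x => v (2 * h - x)) (fun x => -v' (2 * h - x)) h (2 * h - a) := by
  have hle : h ≤ 2 * h - a := by linarith
  refine HasACDeriv.of_eq_integral hle ?_ fun x hx => ?_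
  · have := hv.intervalIntegrable.comp_sub_left (2 * h)
    rw [show 2 * h - h = h by ring] at this
    exact this.symm.neg
  · rw [uIcc_of_le hle] at hx
    have hm : HasACDeriv v v' (2 * h - x) h := hv.mono (by
      rw [uIcc_of_le hah, uIcc_of_le (by linarith [hx.1])]
      exact Icc_subset_Icc_left (by linarith [hx.2]))
    rw [intervalIntegral.integral_neg, intervalIntegral.integral_comp_sub_left (fun x => v' x),
      show 2 * h - h = h by ring, hm.integral_eq_sub]
    ring

theorem HasH1Deriv.hasACDeriv {v v' : ℝ → ℝ} (hv : HasH1Deriv v v') : HasACDeriv v v' 0 1 := by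
  refine HasACDeriv.of_eq_integral zero_le_one ?_ ?_
  · rw [intervalIntegrable_iff_integrableOn_Icc_of_le zero_le_one]
    exact hv.memLp.integrable (by norm_num)
  · rw [uIcc_of_le zero_le_one]
    exact hv.eq_integral

theorem HasH1Deriv.intervalIntegrable_sq {v v' : ℝ → ℝ} (hv : HasH1Deriv v v') :
    IntervalIntegrable (fun x => v' x ^ 2) volume 0 1 := by
  rw [intervalIntegrable_iff_integrableOn_Icc_of_le zero_le_one]
  exact hv.memLp.integrable_sq

/-! ### The kink and its translation mode -/

theorem abs_U_lt_one (x : ℝ) : |U x| < 1 := Real.abs_tanh_lt_one _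

theorem U_sq_lt_one (x : ℝ) : U x ^ 2 < 1 := (sq_lt_one_iff_abs_lt_one _).2 (abs_U_lt_one x)

theorem U_zero : U 0 = 0 := by simp [U]

theorem U_neg (x : ℝ) : U (-x) = -U x := by simp [U, neg_div, Real.tanh_neg]

/-- With `t = x/√2`, `1 - tanh t = exp(-t)/cosh t ≤ 2 exp(-2t)`, and `2t = √2 x ≥ D`. -/
theorem one_sub_U_le {D x : ℝ} (hD : 0 ≤ D) (hx : D ≤ x) : 1 - U x ≤ 2 * Real.exp (-D) := by
  have h2 : (0 : ℝ) < √2 := by positivity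
  have h22 : √2 * √2 = 2 := Real.mul_self_sqrt (by norm_num)
  set t := x / √2 with ht
  have htD : D ≤ 2 * t := by
    have : x = t * √2 := by rw [ht]; field_simp
    have h3 : √2 ≤ 2 := by nlinarith [Real.one_le_sqrt.2 (by norm_num : (1 : ℝ) ≤ 2)]
    have : 0 ≤ t := by rw [ht]; exact div_nonneg (hD.trans hx) h2.le
    nlinarith
  have hU : U x = Real.sinh t / Real.cosh t := by rw [U, Real.tanh_eq_sinh_div_cosh]
  have hc : 0 < Real.cosh t := Real.cosh_pos t
  have h4 : 1 - U x = Real.exp (-t) / Real.cosh t := by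
    rw [hU, ← Real.cosh_sub_sinh]; field_simp
  have h5 : Real.exp t ≤ 2 * Real.cosh t := by
    rw [Real.cosh_eq]; linarith [Real.exp_pos (-t)]
  rw [h4, div_le_iff₀ hc]
  calc Real.exp (-t) = Real.exp (-(2 * t)) * Real.exp t := by rw [← Real.exp_add]; ring_nf
    _ ≤ Real.exp (-D) * (2 * Real.cosh t) := by gcongr
    _ = _ := by ring

/-- In the variable `t = y/√2` this is `t ≤ sinh t cosh t`. It controls the pole of `riccati` at the
centre of the kink. -/
theorem one_sub_U_sq_mul_le {y : ℝ} (hy : 0 ≤ y) : (1 - U y ^ 2) * y ≤ √2 * U y := by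
  have h2 : (0 : ℝ) < √2 := by positivity
  set t := y / √2 with ht
  have hyt : y = t * √2 := by rw [ht]; field_simp
  have ht0 : 0 ≤ t := by positivity
  have hc : 0 < Real.cosh t := Real.cosh_pos t
  have hU : U y = Real.sinh t / Real.cosh t := by rw [U, Real.tanh_eq_sinh_div_cosh]
  have h4 : 1 - U y ^ 2 = 1 / Real.cosh t ^ 2 := by
    rw [hU]; field_simp; linarith [Real.cosh_sq t]
  have h1 : t ≤ Real.sinh t := Real.self_le_sinh_iff.2 ht0
  have h3 : t ≤ Real.sinh t * Real.cosh t := by nlinarith [Real.one_le_cosh t]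
  rw [h4, hU, hyt]
  have : 1 / Real.cosh t ^ 2 * (t * √2) = √2 * (t / Real.cosh t ^ 2) := by ring
  rw [this]
  refine mul_le_mul_of_nonneg_left ?_ h2.le
  rw [div_le_div_iff₀ (by positivity) hc]
  nlinarith

theorem U_pos {y : ℝ} (hy : 0 < y) : 0 < U y := by
  have h2 : (0 : ℝ) < √2 := by positivity
  have := one_sub_U_sq_mul_le hy.le
  have h3 := U_sq_lt_one y
  have : 0 < √2 * U y := lt_of_lt_of_le (mul_pos (by linarith) hy) this
  exact pos_of_mul_pos_right this h2.le

/-- The kink of width `ε` centred at `h`. -/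
noncomputable def kink (ε h x : ℝ) : ℝ := U ((x - h) / ε)

/-- The profile `1 - U²` of the translation mode of the kink. -/
noncomputable def mode (ε h x : ℝ) : ℝ := 1 - kink ε h x ^ 2

theorem mode_pos (ε h x : ℝ) : 0 < mode ε h x := sub_pos.2 (U_sq_lt_one _)

theorem mode_le_one (ε h x : ℝ) : mode ε h x ≤ 1 := sub_le_self _ (sq_nonneg _)

theorem kink_self (ε h : ℝ) : kink ε h h = 0 := by simp [kink, U_zero]

theorem mode_self (ε h : ℝ) : mode ε h h = 1 := by simp [mode, kink_self]

theorem hasDerivAt_kink (ε h x : ℝ) :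
    HasDerivAt (kink ε h) (mode ε h x / (√2 * ε)) x := by
  have h1 : HasDerivAt (fun x : ℝ => (x - h) / ε) (1 / ε) x :=
    ((hasDerivAt_id x).sub_const h).div_const ε
  refine ((hasDerivAt_U _).comp x h1).congr_deriv ?_
  simp only [mode, kink]
  rw [div_mul_div_comm, mul_one]

theorem continuous_kink (ε h : ℝ) : Continuous (kink ε h) :=
  continuous_iff_continuousAt.2 fun x => (hasDerivAt_kink ε h x).continuousAt

theorem continuous_mode (ε h : ℝ) : Continuous (mode ε h) :=
  continuous_const.sub ((continuous_kink ε h).pow 2)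

theorem kink_pos {ε h x : ℝ} (hε : 0 < ε) (hx : h < x) : 0 < kink ε h x :=
  U_pos (div_pos (sub_pos.2 hx) hε)

theorem kink_reflect (ε h x : ℝ) : kink ε h (2 * h - x) = -kink ε h x := by
  rw [kink, kink, ← U_neg]; ring_nf

theorem kink_neg {ε h x : ℝ} (hε : 0 < ε) (hx : x < h) : kink ε h x < 0 := by
  have := kink_pos (h := h) (x := 2 * h - x) hε (by linarith)
  rw [kink_reflect] at this
  linarith

/-! ### Riccati supersolution and the half-cell bound -/

/-- A strict supersolution of the Riccati equation of the linearization at the kink. -/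
noncomputable def riccati (ε h x : ℝ) : ℝ := ε / √2 * (mode ε h x ^ 2 / kink ε h x)

theorem hasDerivAt_mode {ε : ℝ} (h x : ℝ) :
    HasDerivAt (mode ε h) (-(2 * kink ε h x * (mode ε h x / (√2 * ε)))) x := by
  refine (((hasDerivAt_kink ε h x).fun_pow 2).const_sub 1).congr_deriv ?_
  push_cast
  ring

theorem hasDerivAt_riccati {ε h x : ℝ} (hε : 0 < ε) (hk : kink ε h x ≠ 0) :
    HasDerivAt (riccati ε h)
      (-(mode ε h x ^ 2 * (1 + 3 * kink ε h x ^ 2) / (2 * kink ε h x ^ 2))) x := by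
  refine ((((hasDerivAt_mode h x).fun_pow 2).div (hasDerivAt_kink ε h x) hk).const_mul
    (ε / √2)).congr_deriv ?_
  have h2 : (√2 : ℝ) ^ 2 = 2 := Real.sq_sqrt (by norm_num)
  have hm : mode ε h x = 1 - kink ε h x ^ 2 := rfl
  have hε' := hε.ne'
  push_cast
  field_simp
  rw [h2, hm]
  ring

/-- Completing the square in `z'` reduces this to `P' + P²/ε² ≤ 3k² - 2` for `P = riccati`, a
polynomial inequality in `t = k²`. Here `P = ε²w'/w` with `w = k exp(-k²/2)`. -/
theorem riccati_ineq {ε h x : ℝ} (hε : 0 < ε) (hk : kink ε h x ≠ 0) (z z' : ℝ) :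
    -(mode ε h x ^ 2 * (1 + 3 * kink ε h x ^ 2) / (2 * kink ε h x ^ 2)) * (z * z)
      + riccati ε h x * (z' * z + z * z') ≤ ε ^ 2 * z' ^ 2 + (3 * kink ε h x ^ 2 - 2) * z ^ 2 := by
  have h2 : (√2 : ℝ) ^ 2 = 2 := Real.sq_sqrt (by norm_num)
  set P := riccati ε h x with hP
  set t := kink ε h x ^ 2 with ht
  have ht0 : 0 < t := by positivity
  have ht1 : t ≤ 1 := (U_sq_lt_one _).le
  have hm : mode ε h x = 1 - t := rfl
  have hP2 : P ^ 2 = ε ^ 2 * ((1 - t) ^ 4 / (2 * t)) := by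
    rw [hP, riccati, hm, ht]
    field_simp
    rw [h2]
    ring
  have hsum : -((1 - t) ^ 2 * (1 + 3 * t) / (2 * t)) + (1 - t) ^ 4 / (2 * t)
      = -((1 - t) ^ 2 * (5 - t) / 2) := by
    field_simp
    ring
  -- Equivalent to `1 - 5t + 7t² - t³ ≥ 0` on `[0, 1]`. The minimum, near `t = 0.39`, is positive
  -- but small, whence the two squares.
  have hpoly : -((1 - t) ^ 2 * (5 - t) / 2) ≤ 3 * t - 2 := by
    nlinarith [mul_nonneg (sub_nonneg.2 ht1) (sq_nonneg (t - 0.4)), sq_nonneg (t - 0.39)]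
  have hsq : 2 * P * z * z' ≤ ε ^ 2 * z' ^ 2 + ((1 - t) ^ 4 / (2 * t)) * z ^ 2 := by
    have h1 : ((1 - t) ^ 4 / (2 * t)) = (P / ε) ^ 2 := by
      rw [div_pow, hP2]; field_simp
    have h3 : 2 * P * z * z' = 2 * (ε * z') * (P / ε * z) := by field_simp
    rw [h1, h3]
    nlinarith [two_mul_le_add_sq (ε * z') (P / ε * z)]
  rw [hm]
  nlinarith [mul_le_mul_of_nonneg_right (hsum.le.trans hpoly) (sq_nonneg z)]

theorem riccati_le {ε h x : ℝ} (hε : 0 < ε) (hx : h < x) :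
    riccati ε h x ≤ ε ^ 2 / (x - h) := by
  have h22 : √2 * √2 = 2 := Real.mul_self_sqrt (by norm_num)
  have h2 : (0 : ℝ) < √2 := by positivity
  have hxh : 0 < x - h := sub_pos.2 hx
  have hk := kink_pos hε hx
  have hm := mode_pos ε h x
  have hm1 := mode_le_one ε h x
  have := one_sub_U_sq_mul_le (y := (x - h) / ε) (by positivity)
  change mode ε h x * ((x - h) / ε) ≤ √2 * kink ε h x at this
  rw [← mul_div_assoc, div_le_iff₀ hε] at this
  rw [riccati, div_mul_div_comm, div_le_div_iff₀ (by positivity) hxh]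
  calc ε * mode ε h x ^ 2 * (x - h) = ε * mode ε h x * (mode ε h x * (x - h)) := by ring
    _ ≤ ε * 1 * (√2 * kink ε h x * ε) := by gcongr
    _ = _ := by ring

theorem riccati_nonneg {ε h x : ℝ} (hε : 0 < ε) (hx : h ≤ x) : 0 ≤ riccati ε h x := by
  have : 0 ≤ kink ε h x := by
    rcases hx.eq_or_lt with rfl | hx
    · exact (kink_self _ _).ge
    · exact (kink_pos hε hx).le
  rw [riccati]
  positivity

theorem intervalIntegrable_energy {v v' V : ℝ → ℝ} {a b : ℝ} (hv : HasACDeriv v v' a b)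
    (h2 : IntervalIntegrable (fun x => v' x ^ 2) volume a b) (hV : ContinuousOn V (uIcc a b))
    (ε : ℝ) : IntervalIntegrable (fun x => ε ^ 2 * v' x ^ 2 + V x * v x ^ 2) volume a b :=
  (h2.const_mul _).add ((hV.mul (hv.continuousOn.pow 2)).intervalIntegrable)

/-- The left side of `riccati_ineq` is the derivative of `P z²`. -/
theorem riccati_sub_le_integral {ε h a b : ℝ} {z z' : ℝ → ℝ} (hε : 0 < ε) (hab : a ≤ b)
    (hk : ∀ x ∈ uIcc a b, kink ε h x ≠ 0) (hz : HasACDeriv z z' a b)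
    (h2 : IntervalIntegrable (fun x => z' x ^ 2) volume a b) :
    riccati ε h b * z b ^ 2 - riccati ε h a * z a ^ 2
      ≤ ∫ x in a..b, (ε ^ 2 * z' x ^ 2 + (3 * kink ε h x ^ 2 - 2) * z x ^ 2) := by
  have hkc := (continuous_kink ε h).continuousOn (s := uIcc a b)
  have hmc := (continuous_mode ε h).continuousOn (s := uIcc a b)
  have hP : HasACDeriv (riccati ε h)
      (fun x => -(mode ε h x ^ 2 * (1 + 3 * kink ε h x ^ 2) / (2 * kink ε h x ^ 2))) a b := by
    refine HasACDeriv.of_hasDerivAt (fun x hx => hasDerivAt_riccati hε (hk x hx)) ?_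
    refine (ContinuousOn.div ?_ ?_ fun x hx => ?_).neg
    · fun_prop
    · fun_prop
    · have := hk x hx
      positivity
  have hG := hP.mul (hz.mul hz)
  rw [sq (z b), sq (z a), ← hG.integral_eq_sub]
  refine intervalIntegral.integral_mono_on hab hG.intervalIntegrable
    (intervalIntegrable_energy hz h2 (by fun_prop) ε) fun x hx => ?_
  rw [← uIcc_of_le hab] at hx
  exact riccati_ineq hε (hk x hx) (z x) (z' x)

theorem neg_two_le_potential (ε h x : ℝ) : -2 ≤ 3 * kink ε h x ^ 2 - 2 := by
  nlinarith [sq_nonneg (kink ε h x)]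

/-- Spectral bound for the kink on a half cell, with a Dirichlet condition at the centre and a
free end. -/
theorem energy_nonneg_right {ε h b : ℝ} {z z' : ℝ → ℝ} (hε : 0 < ε) (hb : h < b)
    (hz : HasACDeriv z z' h b) (h2 : IntervalIntegrable (fun x => z' x ^ 2) volume h b)
    (h0 : z h = 0) :
    0 ≤ ∫ x in h..b, (ε ^ 2 * z' x ^ 2 + (3 * kink ε h x ^ 2 - 2) * z x ^ 2) := by
  have hkc := continuous_kink ε h
  obtain ⟨M, hM⟩ := isCompact_uIcc.exists_bound_of_continuousOn hz.continuousOn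
  -- `riccati` blows up at `h`, so it is used only on `[d, b]`; the loss on `[h, d]` tends to zero
  -- with `d - h`.
  have key : ∀ d ∈ Ioo h b, -(2 * M ^ 2) * (d - h)
      ≤ ∫ x in h..b, (ε ^ 2 * z' x ^ 2 + (3 * kink ε h x ^ 2 - 2) * z x ^ 2) := by
    rintro d ⟨hd, hdb⟩
    have s1 : uIcc h d ⊆ uIcc h b := by
      rw [uIcc_of_le hd.le, uIcc_of_le hb.le]; exact Icc_subset_Icc_right hdb.le
    have s2 : uIcc d b ⊆ uIcc h b := by
      rw [uIcc_of_le hdb.le, uIcc_of_le hb.le]; exact Icc_subset_Icc_left hd.le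
    have z1 := hz.mono s1
    have z2 := hz.mono s2
    have i1 := h2.mono_set s1
    have i2 := h2.mono_set s2
    have e1 := intervalIntegrable_energy (V := fun x => 3 * kink ε h x ^ 2 - 2) z1 i1
      (by fun_prop) ε
    have e2 := intervalIntegrable_energy (V := fun x => 3 * kink ε h x ^ 2 - 2) z2 i2
      (by fun_prop) ε
    have hR := riccati_sub_le_integral (h := h) hε hdb.le (fun x hx => by
      rw [uIcc_of_le hdb.le] at hx
      exact (kink_pos hε (hd.trans_le hx.1)).ne') z2 i2
    have hPb := mul_nonneg (riccati_nonneg hε hb.le) (sq_nonneg (z b))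
    -- Since `z h = 0`, Cauchy–Schwarz on `[h, d]` exactly offsets the pole `ε²/(d - h)`, so the
    -- gradient energy there pays for the boundary term at `d`.
    have hPd : riccati ε h d * z d ^ 2 ≤ ε ^ 2 * ∫ x in h..d, z' x ^ 2 := by
      have := z1.sq_sub_le hd i1
      rw [h0, sub_zero] at this
      have hdh : 0 < d - h := sub_pos.2 hd
      calc riccati ε h d * z d ^ 2
          ≤ ε ^ 2 / (d - h) * ((d - h) * ∫ x in h..d, z' x ^ 2) := by
            gcongr
            exact riccati_le hε hd
        _ = _ := by field_simp
    have hL : (ε ^ 2 * ∫ x in h..d, z' x ^ 2) - 2 * M ^ 2 * (d - h)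
        ≤ ∫ x in h..d, (ε ^ 2 * z' x ^ 2 + (3 * kink ε h x ^ 2 - 2) * z x ^ 2) := by
      have : (ε ^ 2 * ∫ x in h..d, z' x ^ 2) - 2 * M ^ 2 * (d - h)
          = ∫ x in h..d, (ε ^ 2 * z' x ^ 2 - 2 * M ^ 2) := by
        rw [intervalIntegral.integral_sub (i1.const_mul _) (by simp),
          intervalIntegral.integral_const_mul, intervalIntegral.integral_const, smul_eq_mul]
        ring
      rw [this]
      refine intervalIntegral.integral_mono_on hd.le ((i1.const_mul _).sub (by simp)) e1
        fun x hx => ?_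
      rw [← uIcc_of_le hd.le] at hx
      have hzx := hM x (s1 hx)
      rw [Real.norm_eq_abs] at hzx
      have hz2 : z x ^ 2 ≤ M ^ 2 := by
        rw [← sq_abs]; gcongr
      nlinarith [neg_two_le_potential ε h x, sq_nonneg (z x), mul_nonneg
        (sub_nonneg.2 (neg_two_le_potential ε h x)) (sq_nonneg (z x))]
    rw [← intervalIntegral.integral_add_adjacent_intervals e1 e2]
    linarith
  have hlim : Tendsto (fun d => -(2 * M ^ 2) * (d - h)) (𝓝[>] h) (𝓝 0) := by
    have : Continuous fun d => -(2 * M ^ 2) * (d - h) := by fun_prop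
    have := (this.tendsto h).mono_left (nhdsWithin_le_nhds (s := Ioi h))
    simpa using this
  refine le_of_tendsto hlim ?_
  filter_upwards [Ioo_mem_nhdsGT hb] with d hd using key d hd

/-- Reflection about `h` changes the sign of the kink, and the potential depends only on its square.
-/
theorem energy_nonneg_left {ε h a : ℝ} {z z' : ℝ → ℝ} (hε : 0 < ε) (ha : a < h)
    (hz : HasACDeriv z z' a h) (h2 : IntervalIntegrable (fun x => z' x ^ 2) volume a h)
    (h0 : z h = 0) :
    0 ≤ ∫ x in a..h, (ε ^ 2 * z' x ^ 2 + (3 * kink ε h x ^ 2 - 2) * z x ^ 2) := by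
  have h2' := (h2.comp_sub_left (2 * h)).symm
  rw [show 2 * h - h = h by ring] at h2'
  have := energy_nonneg_right (b := 2 * h - a) hε (by linarith) (hz.reflect ha.le)
    (by simpa only [neg_sq] using h2') (by simpa only [two_mul, add_sub_cancel_right] using h0)
  have h3 := intervalIntegral.integral_comp_sub_left (a := h) (b := 2 * h - a)
    (fun x => ε ^ 2 * z' x ^ 2 + (3 * kink ε h x ^ 2 - 2) * z x ^ 2) (2 * h)
  rw [show 2 * h - h = h by ring, sub_sub_cancel] at h3
  rw [← h3]
  simpa only [kink_reflect, neg_sq] using this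

/-! ### Coercivity on one cell -/

/-- The derivative of `mode`. -/
noncomputable def modeDeriv (ε h x : ℝ) : ℝ := -(2 * kink ε h x * (mode ε h x / (√2 * ε)))

theorem continuous_modeDeriv (ε h : ℝ) : Continuous (modeDeriv ε h) :=
  ((continuous_const.mul (continuous_kink ε h)).mul ((continuous_mode ε h).div_const _)).neg

theorem hasDerivAt_modeDeriv {ε : ℝ} (hε : 0 < ε) (h x : ℝ) :
    HasDerivAt (modeDeriv ε h) ((3 * kink ε h x ^ 2 - 1) * mode ε h x / ε ^ 2) x := by
  have h22 : √2 ^ 2 = 2 := Real.sq_sqrt (by norm_num)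
  refine ((((hasDerivAt_kink ε h x).const_mul 2).mul
    ((hasDerivAt_mode h x).div_const (√2 * ε))).neg).congr_deriv ?_
  have hm : mode ε h x = 1 - kink ε h x ^ 2 := rfl
  field_simp
  rw [h22, hm]
  ring

theorem sq_mul_abs_modeDeriv_le {ε : ℝ} (hε : 0 < ε) (h x : ℝ) :
    ε ^ 2 * |modeDeriv ε h x| ≤ 2 * ε * mode ε h x := by
  have h1 : 1 ≤ √2 := Real.one_le_sqrt.2 (by norm_num)
  have hm := mode_pos ε h x
  have hk : |kink ε h x| ≤ 1 := (abs_U_lt_one _).le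
  rw [modeDeriv, abs_neg, abs_mul, abs_mul, abs_of_pos (show (0 : ℝ) < 2 by norm_num),
    abs_of_pos (show 0 < mode ε h x / (√2 * ε) by positivity)]
  calc ε ^ 2 * (2 * |kink ε h x| * (mode ε h x / (√2 * ε)))
      ≤ ε ^ 2 * (2 * 1 * (mode ε h x / (1 * ε))) := by gcongr
    _ = 2 * ε * mode ε h x := by field_simp

/-- The linearized energy on a cell with free ends controls the squared `L²` norm, up to the
component along the translation mode and boundary terms in which the mode is small. -/
theorem cell_estimate {ε h a b S δ τ : ℝ} {v v' : ℝ → ℝ} (hε : 0 < ε) (ha : a < h) (hb : h < b)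
    (hv : HasACDeriv v v' a b) (h2 : IntervalIntegrable (fun x => v' x ^ 2) volume a b)
    (hS : ∀ x ∈ Icc a b, |v x| ≤ S) (hma : mode ε h a ≤ δ) (hmb : mode ε h b ≤ δ)
    (hτ : |∫ x in a..b, v x * mode ε h x| ≤ τ) :
    (∫ x in a..b, v x ^ 2) - (2 * S * τ + 8 * ε * δ * S ^ 2)
      ≤ ∫ x in a..b, (ε ^ 2 * v' x ^ 2 + (3 * kink ε h x ^ 2 - 1) * v x ^ 2) := by
  have hab : a < b := ha.trans hb
  have hkc := continuous_kink ε h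
  have hmc := continuous_mode ε h
  have hdc := continuous_modeDeriv ε h
  have hvc := hv.continuousOn
  -- The multiple of the mode is chosen to make the difference vanish at the centre, where `mode`
  -- equals `1`; it is not the `L²` projection.
  set c := v h with hc
  have hφ : HasACDeriv (fun x => c * mode ε h x) (fun x => c * modeDeriv ε h x) a b :=
    HasACDeriv.of_hasDerivAt (fun x _ => (hasDerivAt_mode h x).const_mul c) (by fun_prop)
  have hφ' : HasACDeriv (modeDeriv ε h)
      (fun x => (3 * kink ε h x ^ 2 - 1) * mode ε h x / ε ^ 2) a b :=
    HasACDeriv.of_hasDerivAt (fun x _ => hasDerivAt_modeDeriv hε h x) (by fun_prop)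
  have hφ0 : HasACDeriv (mode ε h) (modeDeriv ε h) a b :=
    HasACDeriv.of_hasDerivAt (fun x _ => hasDerivAt_mode h x) (by fun_prop)
  have hz := hv.sub hφ
  have hz2 : IntervalIntegrable (fun x => (v' x - c * modeDeriv ε h x) ^ 2) volume a b := by
    have : (fun x => (v' x - c * modeDeriv ε h x) ^ 2)
        = fun x => v' x ^ 2 - 2 * c * (v' x * modeDeriv ε h x) + c ^ 2 * modeDeriv ε h x ^ 2 := by
      funext x; ring
    rw [this]
    exact (h2.sub ((hv.intervalIntegrable.mul_continuousOn hdc.continuousOn).const_mul _)).add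
      (Continuous.intervalIntegrable (by fun_prop) _ _)
  have hz0 : v h - c * mode ε h h = 0 := by rw [mode_self, mul_one, sub_self]
  have sl : uIcc a h ⊆ uIcc a b := by
    rw [uIcc_of_le ha.le, uIcc_of_le hab.le]; exact Icc_subset_Icc_right hb.le
  have sr : uIcc h b ⊆ uIcc a b := by
    rw [uIcc_of_le hb.le, uIcc_of_le hab.le]; exact Icc_subset_Icc_left ha.le
  have el := energy_nonneg_left hε ha (hz.mono sl) (hz2.mono_set sl) hz0
  have er := energy_nonneg_right hε hb (hz.mono sr) (hz2.mono_set sr) hz0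
  have iz := intervalIntegrable_energy (V := fun x => 3 * kink ε h x ^ 2 - 2) hz hz2
    (by fun_prop) ε
  have hz1 := add_nonneg el er
  rw [intervalIntegral.integral_add_adjacent_intervals (iz.mono_set sl) (iz.mono_set sr)] at hz1
  have iv := intervalIntegrable_energy (V := fun x => 3 * kink ε h x ^ 2 - 1) hv h2
    (by fun_prop) ε
  have ib1 := (hv.mul hφ').intervalIntegrable
  have ib2 := (hφ0.mul hφ').intervalIntegrable
  have iv2 : IntervalIntegrable (fun x => v x ^ 2) volume a b := (hvc.pow 2).intervalIntegrable
  have ivm : IntervalIntegrable (fun x => v x * mode ε h x) volume a b :=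
    (hvc.mul hmc.continuousOn).intervalIntegrable
  have imm : IntervalIntegrable (fun x => mode ε h x ^ 2) volume a b :=
    (hmc.pow 2).intervalIntegrable _ _
  -- By `ε²φ'' = (3k² - 1)φ`, the terms containing `φ` in the energy with potential `3k² - 1` are
  -- total derivatives. Replacing `3k² - 1` by `3k² - 2` subtracts `∫ (v - cφ)²`, the source of the
  -- last three integrals.
  have hident : ∫ x in a..b, (ε ^ 2 * (v' x - c * modeDeriv ε h x) ^ 2
        + (3 * kink ε h x ^ 2 - 2) * (v x - c * mode ε h x) ^ 2)
      = (∫ x in a..b, (ε ^ 2 * v' x ^ 2 + (3 * kink ε h x ^ 2 - 1) * v x ^ 2))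
        - 2 * c * ε ^ 2 * (v b * modeDeriv ε h b - v a * modeDeriv ε h a)
        + c ^ 2 * ε ^ 2 * (mode ε h b * modeDeriv ε h b - mode ε h a * modeDeriv ε h a)
        - (∫ x in a..b, v x ^ 2) + 2 * c * (∫ x in a..b, v x * mode ε h x)
        - c ^ 2 * ∫ x in a..b, mode ε h x ^ 2 := by
    rw [← (hv.mul hφ').integral_eq_sub, ← (hφ0.mul hφ').integral_eq_sub]
    simp only [← intervalIntegral.integral_const_mul]
    rw [← intervalIntegral.integral_sub iv (ib1.const_mul _),
      ← intervalIntegral.integral_add (iv.sub (ib1.const_mul _)) (ib2.const_mul _),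
      ← intervalIntegral.integral_sub
        ((iv.sub (ib1.const_mul _)).add (ib2.const_mul _)) iv2,
      ← intervalIntegral.integral_add
        (((iv.sub (ib1.const_mul _)).add (ib2.const_mul _)).sub iv2) (ivm.const_mul _),
      ← intervalIntegral.integral_sub
        ((((iv.sub (ib1.const_mul _)).add (ib2.const_mul _)).sub iv2).add (ivm.const_mul _))
        (imm.const_mul _)]
    refine intervalIntegral.integral_congr fun x _ => ?_
    field_simp
    ring
  rw [hident] at hz1
  have hcS : |c| ≤ S := hS h ⟨ha.le, hb.le⟩
  have hS0 : 0 ≤ S := (abs_nonneg c).trans hcS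
  have hb0 : modeDeriv ε h b ≤ 0 := by
    have := kink_pos hε hb
    have := mode_pos ε h b
    rw [modeDeriv, neg_nonpos]
    positivity
  have ha0 : 0 ≤ modeDeriv ε h a := by
    have := kink_neg hε ha
    have h3 : 0 < mode ε h a / (√2 * ε) := div_pos (mode_pos ε h a) (by positivity)
    rw [modeDeriv, neg_nonneg]
    nlinarith
  have hend : ∀ x, |v x| ≤ S → mode ε h x ≤ δ → |c * (ε ^ 2 * (v x * modeDeriv ε h x))|
      ≤ 2 * ε * δ * S ^ 2 := fun x hx hm => by
    rw [abs_mul, abs_mul, abs_mul, abs_of_pos (show 0 < ε ^ 2 by positivity)]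
    calc |c| * (ε ^ 2 * (|v x| * |modeDeriv ε h x|))
        = |c| * |v x| * (ε ^ 2 * |modeDeriv ε h x|) := by ring
      _ ≤ S * S * (2 * ε * δ) := by
        refine mul_le_mul (by gcongr) ((sq_mul_abs_modeDeriv_le hε h x).trans (by gcongr))
          (by positivity) (by positivity)
      _ = _ := by ring
  have e1 := abs_le.1 (hend a (hS a ⟨le_rfl, hab.le⟩) hma)
  have e2 := abs_le.1 (hend b (hS b ⟨hab.le, le_rfl⟩) hmb)
  have e3 : |c * ∫ x in a..b, v x * mode ε h x| ≤ S * τ := by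
    rw [abs_mul]; gcongr
  have e4 := abs_le.1 e3
  have e5 : 0 ≤ c ^ 2 * ∫ x in a..b, mode ε h x ^ 2 :=
    mul_nonneg (sq_nonneg _) (intervalIntegral.integral_nonneg hab.le fun x _ => sq_nonneg _)
  -- The mode increases to the left of its centre and decreases to the right, so this boundary term
  -- has the favourable sign.
  have e6 : c ^ 2 * ε ^ 2 * (mode ε h b * modeDeriv ε h b - mode ε h a * modeDeriv ε h a) ≤ 0 :=
    mul_nonpos_of_nonneg_of_nonpos (by positivity)
      (by nlinarith [mul_nonneg (mode_pos ε h a).le ha0,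
        mul_nonneg (mode_pos ε h b).le (neg_nonneg.2 hb0)])
  have e7 : 2 * c * ε ^ 2 * (v b * modeDeriv ε h b - v a * modeDeriv ε h a)
      = 2 * (c * (ε ^ 2 * (v b * modeDeriv ε h b)))
        - 2 * (c * (ε ^ 2 * (v a * modeDeriv ε h a))) := by ring
  have e8 : 2 * c * (∫ x in a..b, v x * mode ε h x)
      = 2 * (c * ∫ x in a..b, v x * mode ε h x) := by ring
  rw [e7, e8] at hz1
  linarith [e1.1, e1.2, e2.1, e2.2, e4.1, e4.2]

/-! ### Partition into cells -/

/-- A partition `0 = m₀ < … < m_{N+1} = 1` whose `k`-th cell `[m_k, m_{k+1}]` contains the centre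
`c_k` at distance at least `d` from both ends. -/
structure IsCellPartition (N : ℕ) (d : ℝ) (m c : ℕ → ℝ) : Prop where
  pos : 0 < d
  zero : m 0 = 0
  one : m (N + 1) = 1
  left : ∀ k ≤ N, m k + d ≤ c k
  right : ∀ k ≤ N, c k + d ≤ m (k + 1)

namespace IsCellPartition

variable {N : ℕ} {d : ℝ} {m c : ℕ → ℝ}

theorem mono (H : IsCellPartition N d m c) {i j : ℕ} (hij : i ≤ j) (hj : j ≤ N + 1) :
    m i ≤ m j := by
  induction j, hij using Nat.le_induction with
  | base => exact le_rfl
  | succ j hij ih =>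
    have := H.left j (by omega)
    have := H.right j (by omega)
    linarith [ih (by omega), H.pos]

theorem mem_Icc (H : IsCellPartition N d m c) {k : ℕ} (hk : k ≤ N + 1) : m k ∈ Icc (0 : ℝ) 1 :=
  ⟨H.zero ▸ H.mono (Nat.zero_le k) hk, H.one ▸ H.mono hk le_rfl⟩

theorem cell_subset (H : IsCellPartition N d m c) {k : ℕ} (hk : k ≤ N) :
    Icc (m k) (m (k + 1)) ⊆ Icc 0 1 :=
  Icc_subset_Icc (H.mem_Icc (by omega)).1 (H.mem_Icc (by omega)).2

theorem lt_center (H : IsCellPartition N d m c) {k : ℕ} (hk : k ≤ N) : m k < c k := by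
  linarith [H.left k hk, H.pos]

theorem center_lt (H : IsCellPartition N d m c) {k : ℕ} (hk : k ≤ N) : c k < m (k + 1) := by
  linarith [H.right k hk, H.pos]

theorem one_sub_kink_le {ε : ℝ} (H : IsCellPartition N d m c) (hε : 0 < ε) {k : ℕ} {x : ℝ}
    (hx : c k + d ≤ x) : 1 - kink ε (c k) x ≤ 2 * Real.exp (-(d / ε)) := by
  refine one_sub_U_le (div_nonneg H.pos.le hε.le) ?_
  gcongr
  linarith

theorem one_add_kink_le {ε : ℝ} (H : IsCellPartition N d m c) (hε : 0 < ε) {k : ℕ} {x : ℝ}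
    (hx : x ≤ c k - d) : 1 + kink ε (c k) x ≤ 2 * Real.exp (-(d / ε)) := by
  have := H.one_sub_kink_le hε (k := k) (x := 2 * c k - x) (by linarith)
  rwa [kink_reflect, sub_neg_eq_add] at this

theorem mode_le {ε : ℝ} (H : IsCellPartition N d m c) (hε : 0 < ε) {k : ℕ} {x : ℝ}
    (hx : x ≤ c k - d ∨ c k + d ≤ x) : mode ε (c k) x ≤ 4 * Real.exp (-(d / ε)) := by
  have h1 := abs_lt.1 (abs_U_lt_one ((x - c k) / ε))
  change -1 < kink ε (c k) x ∧ kink ε (c k) x < 1 at h1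
  have h2 : mode ε (c k) x = (1 - kink ε (c k) x) * (1 + kink ε (c k) x) := by rw [mode]; ring
  rw [h2]
  rcases hx with hx | hx
  · nlinarith [H.one_add_kink_le hε hx]
  · nlinarith [H.one_sub_kink_le hε hx]

theorem abs_kink_sub_le {ε : ℝ} (H : IsCellPartition N d m c) (hε : 0 < ε) {j k : ℕ} (hj : j ≤ N)
    (hk : k ≤ N) {x : ℝ} (hx : x ∈ Icc (m j) (m (j + 1))) :
    |kink ε (c k) x - if k < j then 1 else if k = j then kink ε (c j) x else -1|
      ≤ 2 * Real.exp (-(d / ε)) := by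
  have h1 := abs_lt.1 (abs_U_lt_one ((x - c k) / ε))
  change -1 < kink ε (c k) x ∧ kink ε (c k) x < 1 at h1
  split_ifs with h2 h3
  · have h4 := H.one_sub_kink_le hε (k := k) (x := x) (by
      linarith [H.right k hk, H.mono (show k + 1 ≤ j by omega) (by omega), hx.1])
    rw [abs_le]; constructor <;> linarith
  · subst h3
    rw [sub_self, abs_zero]
    positivity
  · have h4 := H.one_add_kink_le hε (k := k) (x := x) (by
      linarith [H.left k hk, H.mono (show j + 1 ≤ k by omega) (by omega), hx.2])
    rw [abs_le]; constructor <;> linarith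

end IsCellPartition

theorem sum_range_neg_one_pow (j : ℕ) :
    ∑ k ∈ Finset.range j, (-1 : ℝ) ^ k = (1 - (-1) ^ j) / 2 := by
  induction j with
  | zero => simp
  | succ j ih => rw [Finset.sum_range_succ, ih, pow_succ]; ring

/-- Seen from cell `j`, the kinks to the left have saturated at `1` and those to the right at `-1`.
The leftover constant does not depend on `j` and is cancelled by the limit of `β`. -/
theorem sum_alternating_step {N j : ℕ} (hj : j ≤ N) (y : ℝ) :
    ∑ k ∈ Finset.range (N + 1), (-1 : ℝ) ^ k * (if k < j then 1 else if k = j then y else -1)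
      = (-1) ^ j * y + (1 - (-1) ^ N) / 2 := by
  induction N, hj using Nat.le_induction with
  | base =>
    rw [Finset.sum_range_succ]
    have : ∑ k ∈ Finset.range j, (-1 : ℝ) ^ k * (if k < j then 1 else if k = j then y else -1)
        = ∑ k ∈ Finset.range j, (-1 : ℝ) ^ k := by
      refine Finset.sum_congr rfl fun k hk => ?_
      rw [if_pos (Finset.mem_range.1 hk), mul_one]
    rw [this, sum_range_neg_one_pow, if_neg (lt_irrefl j), if_pos rfl]
    ring
  | succ N hN ih =>
    rw [Finset.sum_range_succ, ih, if_neg (by omega), if_neg (by omega), pow_succ]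
    ring

theorem IsCellPartition.abs_sum_sub_kink_le {N : ℕ} {d ε : ℝ} {m c : ℕ → ℝ}
    (H : IsCellPartition N d m c) (hε : 0 < ε) {j : ℕ} (hj : j ≤ N) {x : ℝ}
    (hx : x ∈ Icc (m j) (m (j + 1))) :
    |∑ k ∈ Finset.range (N + 1), (-1 : ℝ) ^ k * kink ε (c k) x + ((-1) ^ N - 1) / 2
        - (-1) ^ j * kink ε (c j) x| ≤ (N + 1) * (2 * Real.exp (-(d / ε))) := by
  have h1 : ∑ k ∈ Finset.range (N + 1), (-1 : ℝ) ^ k * kink ε (c k) x + ((-1) ^ N - 1) / 2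
      - (-1) ^ j * kink ε (c j) x
      = ∑ k ∈ Finset.range (N + 1), (-1 : ℝ) ^ k * (kink ε (c k) x
        - if k < j then 1 else if k = j then kink ε (c j) x else -1) := by
    simp only [mul_sub, Finset.sum_sub_distrib]
    rw [sum_alternating_step hj]
    ring
  rw [h1]
  refine (Finset.abs_sum_le_sum_abs _ _).trans ?_
  have h2 : ∀ k ∈ Finset.range (N + 1), |(-1 : ℝ) ^ k * (kink ε (c k) x
      - if k < j then 1 else if k = j then kink ε (c j) x else -1)|
      ≤ 2 * Real.exp (-(d / ε)) := fun k hk => by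
    rw [abs_mul, abs_pow, abs_neg, abs_one, one_pow, one_mul]
    exact H.abs_kink_sub_le hε hj (by simpa [Nat.lt_succ_iff] using hk) hx
  refine (Finset.sum_le_card_nsmul _ _ _ h2).trans ?_
  simp

/-- Coercivity of the linearized energy for a function that is close to a kink or an antikink on
every cell, up to errors proportional to the squared supremum norm. -/
theorem IsCellPartition.energy_lower_bound {N : ℕ} {d ε δ τ S : ℝ} {m c : ℕ → ℝ}
    {u v v' : ℝ → ℝ} (H : IsCellPartition N d m c) (hε : 0 < ε) (hε1 : ε ≤ 1)
    (hv : HasACDeriv v v' 0 1) (h2 : IntervalIntegrable (fun x => v' x ^ 2) volume 0 1)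
    (hu : ContinuousOn u (Icc 0 1)) (hS : ∀ x ∈ Icc (0 : ℝ) 1, |v x| ≤ S)
    (huk : ∀ k ≤ N, ∀ x ∈ Icc (m k) (m (k + 1)), |u x - (-1) ^ k * kink ε (c k) x| ≤ δ)
    (hml : ∀ k ≤ N, mode ε (c k) (m k) ≤ δ) (hmr : ∀ k ≤ N, mode ε (c k) (m (k + 1)) ≤ δ)
    (hτ : ∀ k ≤ N, |∫ x in m k..m (k + 1), v x * mode ε (c k) x| ≤ τ) :
    (∫ x in (0 : ℝ)..1, v x ^ 2) - (N + 1) * (2 * S * τ + 14 * δ * S ^ 2)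
      ≤ ∫ x in (0 : ℝ)..1, (ε ^ 2 * v' x ^ 2 + (3 * u x ^ 2 - 1) * v x ^ 2) := by
  have h01 : uIcc (0 : ℝ) 1 = Icc 0 1 := uIcc_of_le zero_le_one
  have huV : ContinuousOn (fun x => 3 * u x ^ 2 - 1) (uIcc 0 1) := by
    rw [h01]
    exact (continuousOn_const.mul (hu.pow 2)).sub continuousOn_const
  have ie := intervalIntegrable_energy hv h2 huV ε
  have iv2 : IntervalIntegrable (fun x => v x ^ 2) volume 0 1 :=
    (hv.continuousOn.pow 2).intervalIntegrable
  have hsub : ∀ k < N + 1, uIcc (m k) (m (k + 1)) ⊆ uIcc 0 1 := fun k hk => by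
    rw [h01, uIcc_of_le (H.mono (Nat.le_succ k) hk)]
    exact H.cell_subset (by omega)
  have s1 := intervalIntegral.sum_integral_adjacent_intervals
    (fun k hk => ie.mono_set (hsub k hk))
  have s2 := intervalIntegral.sum_integral_adjacent_intervals
    (fun k hk => iv2.mono_set (hsub k hk))
  rw [H.zero, H.one] at s1 s2
  rw [← s1, ← s2]
  have hconst : ((N : ℝ) + 1) * (2 * S * τ + 14 * δ * S ^ 2)
      = ∑ k ∈ Finset.range (N + 1), (2 * S * τ + 14 * δ * S ^ 2) := by
    rw [Finset.sum_const, Finset.card_range, nsmul_eq_mul]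
    push_cast
    rfl
  rw [hconst, ← Finset.sum_sub_distrib]
  refine Finset.sum_le_sum fun k hk => ?_
  have hk' : k ≤ N := by simpa [Nat.lt_succ_iff] using hk
  have hlt : m k < m (k + 1) := (H.lt_center hk').trans (H.center_lt hk')
  have hsubk := hsub k (by omega)
  have hvk := hv.mono hsubk
  have hcell := H.cell_subset hk'
  have h2k := h2.mono_set hsubk
  have hδ : 0 ≤ δ := (mode_pos _ _ _).le.trans (hml k hk')
  have hc := cell_estimate hε (H.lt_center hk') (H.center_lt hk') hvk h2k
    (fun x hx => hS x (hcell hx)) (hml k hk') (hmr k hk') (hτ k hk')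
  have hkc := continuous_kink ε (c k)
  have ik := intervalIntegrable_energy (V := fun x => 3 * kink ε (c k) x ^ 2 - 1) hvk h2k
    (by fun_prop) ε
  have hpt : ∫ x in m k..m (k + 1), (ε ^ 2 * v' x ^ 2 + (3 * kink ε (c k) x ^ 2 - 1) * v x ^ 2
      - 6 * δ * S ^ 2)
      ≤ ∫ x in m k..m (k + 1), (ε ^ 2 * v' x ^ 2 + (3 * u x ^ 2 - 1) * v x ^ 2) := by
    refine intervalIntegral.integral_mono_on hlt.le (ik.sub (by simp)) (ie.mono_set hsubk)
      fun x hx => ?_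
    have h3 := huk k hk' x hx
    set s := kink ε (c k) x with hs
    have hs1 : |s| ≤ 1 := (abs_U_lt_one _).le
    -- The profile is `±s + e` with `|e| ≤ δ` and `|s| ≤ 1`; the term `e²` is dropped. This `6δ` and
    -- the `8εδ` of `cell_estimate` make up the `14δ`.
    have h4 : 3 * s ^ 2 - 6 * δ ≤ 3 * u x ^ 2 := by
      set e := u x - (-1) ^ k * s with he
      have hue : u x = (-1) ^ k * s + e := by rw [he]; ring
      have h5 : ((-1 : ℝ) ^ k) ^ 2 = 1 := by rw [← pow_mul, mul_comm, pow_mul]; simp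
      have h6 : |(-1 : ℝ) ^ k * s * e| ≤ δ := by
        rw [abs_mul, abs_mul, abs_pow, abs_neg, abs_one, one_pow, one_mul]
        calc |s| * |e| ≤ 1 * δ := by gcongr
          _ = δ := one_mul δ
      have h7 := (abs_le.1 h6).1
      have h8 : u x ^ 2 = s ^ 2 + 2 * ((-1) ^ k * s * e) + e ^ 2 := by
        rw [hue]; linear_combination s ^ 2 * h5
      nlinarith [sq_nonneg e]
    have h9 : v x ^ 2 ≤ S ^ 2 := by
      rw [← sq_abs]; gcongr; exact hS x (hcell hx)
    nlinarith [mul_le_mul_of_nonneg_right h4 (sq_nonneg (v x)), mul_le_mul_of_nonneg_left h9 hδ]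
  rw [intervalIntegral.integral_sub ik (by simp), intervalIntegral.integral_const,
    smul_eq_mul] at hpt
  have hlen : m (k + 1) - m k ≤ 1 := by
    linarith [(H.mem_Icc (k := k + 1) (by omega)).2, (H.mem_Icc (k := k) (by omega)).1]
  have h10 : (m (k + 1) - m k) * (6 * δ * S ^ 2) ≤ 1 * (6 * δ * S ^ 2) := by gcongr
  have h11 : 8 * ε * δ * S ^ 2 ≤ 8 * 1 * δ * S ^ 2 := by gcongr
  linarith

/-- Orthogonality is an identity on `[0, 1]`; it passes to the cell because on each of the two outer
intervals the mode is at most `4 exp(-d/ε)`. -/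
theorem IsCellPartition.abs_integral_cell_le {N : ℕ} {d ε S : ℝ} {m c : ℕ → ℝ} {v : ℝ → ℝ}
    (H : IsCellPartition N d m c) (hε : 0 < ε) (hv : ContinuousOn v (Icc 0 1))
    (hS : ∀ x ∈ Icc (0 : ℝ) 1, |v x| ≤ S) {k : ℕ} (hk : k ≤ N) :
    |∫ x in m k..m (k + 1), v x * mode ε (c k) x|
      ≤ |∫ x in (0 : ℝ)..1, v x * mode ε (c k) x| + 8 * Real.exp (-(d / ε)) * S := by
  have hm0 := H.mem_Icc (k := k) (by omega)
  have hm1 := H.mem_Icc (k := k + 1) (by omega)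
  have hi : ∀ {a b : ℝ}, a ∈ Icc (0 : ℝ) 1 → b ∈ Icc (0 : ℝ) 1 →
      IntervalIntegrable (fun x => v x * mode ε (c k) x) volume a b := fun ha hb =>
    ((hv.mono (uIcc_subset_Icc ha hb)).mul
      (continuous_mode ε (c k)).continuousOn).intervalIntegrable
  have h0 : (0 : ℝ) ∈ Icc (0 : ℝ) 1 := ⟨le_rfl, zero_le_one⟩
  have h1 : (1 : ℝ) ∈ Icc (0 : ℝ) 1 := ⟨zero_le_one, le_rfl⟩
  have hS0 : 0 ≤ S := (abs_nonneg _).trans (hS 0 h0)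
  have hbd : ∀ {a b : ℝ}, a ∈ Icc (0 : ℝ) 1 → b ∈ Icc (0 : ℝ) 1 → a ≤ b →
      (∀ x ∈ Icc a b, x ≤ c k - d ∨ c k + d ≤ x) →
      |∫ x in a..b, v x * mode ε (c k) x| ≤ 4 * Real.exp (-(d / ε)) * S := by
    intro a b ha hb hab hx
    have := intervalIntegral.norm_integral_le_of_norm_le_const (a := a) (b := b)
      (f := fun x => v x * mode ε (c k) x) (C := 4 * Real.exp (-(d / ε)) * S) fun x hxI => by
        rw [uIoc_of_le hab] at hxI
        have hxI' := Ioc_subset_Icc_self hxI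
        rw [Real.norm_eq_abs, abs_mul, abs_of_pos (mode_pos _ _ _), mul_comm]
        exact mul_le_mul (H.mode_le hε (hx x hxI'))
          (hS x ⟨ha.1.trans hxI'.1, hxI'.2.trans hb.2⟩) (abs_nonneg _) (by positivity)
    refine this.trans ?_
    have h3 : |b - a| ≤ 1 := by
      rw [abs_of_nonneg (sub_nonneg.2 hab)]; linarith [ha.1, hb.2]
    exact mul_le_of_le_one_right (by positivity) h3
  have b1 := hbd h0 hm0 hm0.1 fun x hx => Or.inl (by linarith [hx.2, H.left k hk])
  have b2 := hbd hm1 h1 hm1.2 fun x hx => Or.inr (by linarith [hx.1, H.right k hk])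
  rw [← intervalIntegral.integral_add_adjacent_intervals (hi h0 hm0) (hi hm0 h1),
    ← intervalIntegral.integral_add_adjacent_intervals (hi hm0 hm1) (hi hm1 h1)]
  set A := ∫ x in (0 : ℝ)..m k, v x * mode ε (c k) x
  set B := ∫ x in m k..m (k + 1), v x * mode ε (c k) x
  set D := ∫ x in m (k + 1)..1, v x * mode ε (c k) x
  have h4 : B = (A + (B + D)) - A - D := by ring
  have h5 := abs_sub (A + (B + D) - A) D
  have h6 := abs_sub (A + (B + D)) A
  rw [← h4] at h5
  linarith

/-! ### Sup norm and nonlinear terms -/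

/-- The Sobolev embedding `H¹(0, 1) ⊆ L^∞` with a free parameter. -/
theorem HasACDeriv.sq_le {v v' : ℝ → ℝ} (hv : HasACDeriv v v' 0 1)
    (h2 : IntervalIntegrable (fun x => v' x ^ 2) volume 0 1) {t : ℝ} (ht : 0 < t) {x : ℝ}
    (hx : x ∈ Icc (0 : ℝ) 1) :
    v x ^ 2 ≤ (1 + t) * (∫ y in (0 : ℝ)..1, v y ^ 2) + (∫ y in (0 : ℝ)..1, v' y ^ 2) / t := by
  have h01 : uIcc (0 : ℝ) 1 = Icc 0 1 := uIcc_of_le zero_le_one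
  have iv2 : IntervalIntegrable (fun x => v x ^ 2) volume 0 1 :=
    (hv.continuousOn.pow 2).intervalIntegrable
  have ig : IntervalIntegrable (fun x => t * v x ^ 2 + v' x ^ 2 / t) volume 0 1 :=
    (iv2.const_mul t).add (h2.div_const t)
  -- Integrate `(v²)' = 2vv'`, bounded by `t v² + v'²/t`, from `y` to `x`; averaging over `y` then
  -- gives the claim.
  have key : ∀ y ∈ Icc (0 : ℝ) 1,
      v x ^ 2 - v y ^ 2 ≤ ∫ s in (0 : ℝ)..1, (t * v s ^ 2 + v' s ^ 2 / t) := by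
    intro y hy
    have hsub : uIcc y x ⊆ uIcc 0 1 := by rw [h01]; exact uIcc_subset_Icc hy hx
    have h3 := ((hv.mul hv).mono hsub).integral_eq_sub
    rw [sq, sq, ← h3]
    have h4 := intervalIntegral.norm_integral_le_abs_of_norm_le (μ := volume) (a := y) (b := x)
      (f := fun s => v' s * v s + v s * v' s) (g := fun s => t * v s ^ 2 + v' s ^ 2 / t)
      (Eventually.of_forall fun s => by
        rw [Real.norm_eq_abs, abs_le]
        have e1 : t * v s ^ 2 + v' s ^ 2 / t + (v' s * v s + v s * v' s)
            = (t * v s + v' s) ^ 2 / t := by field_simp; ring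
        have e2 : t * v s ^ 2 + v' s ^ 2 / t - (v' s * v s + v s * v' s)
            = (t * v s - v' s) ^ 2 / t := by field_simp; ring
        have e3 : 0 ≤ (t * v s + v' s) ^ 2 / t := by positivity
        have e4 : 0 ≤ (t * v s - v' s) ^ 2 / t := by positivity
        constructor <;> linarith) (ig.mono_set hsub)
    have hg0 : ∀ s, 0 ≤ t * v s ^ 2 + v' s ^ 2 / t := fun s => by positivity
    have h5 := intervalIntegral.abs_integral_mono_interval (μ := volume) (a := y) (b := x)
      (c := 0) (d := 1) (f := fun s => t * v s ^ 2 + v' s ^ 2 / t)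
      (uIoc_subset_uIoc_of_uIcc_subset_uIcc hsub) (Eventually.of_forall hg0) ig
    rw [abs_of_nonneg (intervalIntegral.integral_nonneg zero_le_one fun s _ => hg0 s)] at h5
    exact (Real.le_norm_self _).trans (h4.trans h5)
  have h6 := intervalIntegral.integral_mono_on zero_le_one
    ((intervalIntegrable_const (c := v x ^ 2)).sub iv2) (intervalIntegrable_const) key
  rw [intervalIntegral.integral_sub (by simp) iv2, intervalIntegral.integral_add
    (iv2.const_mul t) (h2.div_const t), intervalIntegral.integral_const_mul,
    intervalIntegral.integral_div] at h6
  simp only [intervalIntegral.integral_const, sub_zero, one_smul] at h6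
  linarith

theorem deriv_f (u : ℝ) : deriv f u = 3 * u ^ 2 - 1 := by
  have : HasDerivAt f (3 * u ^ 2 - 1) u := by
    refine ((hasDerivAt_pow 3 u).sub (hasDerivAt_id u)).congr_deriv ?_
    norm_num
  exact this.deriv

theorem linForm_eq (ε : ℝ) (u v v' : ℝ → ℝ) :
    linForm ε u v v' = -∫ x in (0 : ℝ)..1, (ε ^ 2 * v' x ^ 2 + (3 * u x ^ 2 - 1) * v x ^ 2) := by
  rw [linForm, ← intervalIntegral.integral_neg]
  refine intervalIntegral.integral_congr fun x _ => ?_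
  simp only [deriv_f]
  ring

theorem nonlin_mul_eq (u v : ℝ → ℝ) (x : ℝ) :
    nonlin u v x * v x = -(3 * u x * v x ^ 3) - v x ^ 4 := by
  simp only [nonlin, deriv_f, f]
  ring

theorem l2norm_sq (v : ℝ → ℝ) : l2norm v ^ 2 = ∫ x in (0 : ℝ)..1, v x ^ 2 := by
  have h : ip v v = ∫ x in (0 : ℝ)..1, v x ^ 2 := by simp only [ip, sq]
  rw [l2norm, Real.sq_sqrt, h]
  rw [h]
  exact intervalIntegral.integral_nonneg zero_le_one fun x _ => sq_nonneg _

/-- The quartic term has the good sign, and the cubic one is at most `3MS v²`. Young's inequality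
makes it quadratic in `S`, the form in which the Sobolev bound applies. -/
theorem ip_nonlin_le {u v : ℝ → ℝ} {M S : ℝ} (hu : ContinuousOn u (Icc 0 1))
    (hv : ContinuousOn v (Icc 0 1)) (hM : ∀ x ∈ Icc (0 : ℝ) 1, |u x| ≤ M)
    (hS : ∀ x ∈ Icc (0 : ℝ) 1, |v x| ≤ S) :
    ip (nonlin u v) v ≤ (1 / 10 + 23 * M ^ 2 * S ^ 2) * ∫ x in (0 : ℝ)..1, v x ^ 2 := by
  have h01 : uIcc (0 : ℝ) 1 = Icc 0 1 := uIcc_of_le zero_le_one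
  simp only [ip, nonlin_mul_eq]
  rw [← intervalIntegral.integral_const_mul]
  rw [← h01] at hu hv
  refine intervalIntegral.integral_mono_on zero_le_one
    (ContinuousOn.intervalIntegrable ((((continuousOn_const.mul hu).mul (hv.pow 3)).neg).sub
      (hv.pow 4))) (ContinuousOn.intervalIntegrable (continuousOn_const.mul (hv.pow 2)))
    fun x hx => ?_
  have h1 : |u x * v x| ≤ M * S := by
    rw [abs_mul]
    exact mul_le_mul (hM x hx) (hS x hx) (abs_nonneg _) ((abs_nonneg _).trans (hM x hx))
  have h2 := (abs_le.1 h1).1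
  have h3 : -(3 * u x * v x ^ 3) - v x ^ 4 ≤ 3 * (M * S) * v x ^ 2 := by
    nlinarith [mul_nonneg (show 0 ≤ u x * v x + M * S by linarith) (sq_nonneg (v x)),
      sq_nonneg (v x ^ 2)]
  have h4 : 3 * (M * S) ≤ 1 / 10 + 23 * M ^ 2 * S ^ 2 := by
    nlinarith [sq_nonneg (15 * (M * S) - 1), sq_nonneg (M * S)]
  exact h3.trans (mul_le_mul_of_nonneg_right h4 (sq_nonneg _))

/-- From a lower bound for the linearized energy with a small supremum norm error to the energy
estimate including the nonlinear terms. -/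
theorem energy_estimate {ε η M r : ℝ} {u v v' : ℝ → ℝ} (hε : 0 < ε) (hε1 : ε ≤ 1)
    (hv : HasACDeriv v v' 0 1) (h2 : IntervalIntegrable (fun x => v' x ^ 2) volume 0 1)
    (hu : ContinuousOn u (Icc 0 1)) (hM0 : 0 < M) (hM : ∀ x ∈ Icc (0 : ℝ) 1, |u x| ≤ M)
    (hη : η ≤ ε ^ 2 / 100) (hr0 : 0 < r)
    (hr : 23 * M ^ 2 * r + 23000 * M ^ 4 * (r ^ 2 / ε ^ 2) ≤ 1 / 100)
    (hX : ∫ x in (0 : ℝ)..1, v x ^ 2 ≤ r)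
    (hlow : ∀ S, (∀ x ∈ Icc (0 : ℝ) 1, |v x| ≤ S) → (∫ x in (0 : ℝ)..1, v x ^ 2) - η * S ^ 2
      ≤ ∫ x in (0 : ℝ)..1, (ε ^ 2 * v' x ^ 2 + (3 * u x ^ 2 - 1) * v x ^ 2)) :
    linForm ε u v v' + ip (nonlin u v) v ≤ -(1 / 2) * lambda0 * l2norm v ^ 2 := by
  have h01 : uIcc (0 : ℝ) 1 = Icc 0 1 := uIcc_of_le zero_le_one
  have hvc : ContinuousOn v (Icc 0 1) := h01 ▸ hv.continuousOn
  obtain ⟨x₀, hx₀, hmax⟩ := isCompact_Icc.exists_isMaxOn (nonempty_Icc.2 zero_le_one)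
    (hvc.norm)
  set S := |v x₀| with hSdef
  have hS : ∀ x ∈ Icc (0 : ℝ) 1, |v x| ≤ S := fun x hx => hmax hx
  have hS2 : S ^ 2 = v x₀ ^ 2 := sq_abs _
  have hnl := ip_nonlin_le hu hvc hM hS
  have hl := hlow S hS
  have hs1 := hv.sq_le h2 zero_lt_one hx₀
  -- Chosen so that the gradient part of `23M²S²r` becomes the fixed small fraction `23/1000` of
  -- `ε²Y`; the rest is the quantity bounded by `hr`.
  set t := 1000 * M ^ 2 * r / ε ^ 2 with ht
  have ht0 : 0 < t := by positivity
  have hs2 := hv.sq_le h2 ht0 hx₀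
  rw [← hS2] at hs1 hs2
  -- The coercive bound contains no gradient. A small share of this crude bound, from `3u² - 1 ≥
  -- -1`, supplies one.
  have hcrude : ε ^ 2 * (∫ x in (0 : ℝ)..1, v' x ^ 2) - (∫ x in (0 : ℝ)..1, v x ^ 2)
      ≤ ∫ x in (0 : ℝ)..1, (ε ^ 2 * v' x ^ 2 + (3 * u x ^ 2 - 1) * v x ^ 2) := by
    have iv2 : IntervalIntegrable (fun x => v x ^ 2) volume 0 1 :=
      (hv.continuousOn.pow 2).intervalIntegrable
    rw [← intervalIntegral.integral_const_mul,
      ← intervalIntegral.integral_sub (h2.const_mul _) iv2]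
    refine intervalIntegral.integral_mono_on zero_le_one ((h2.const_mul _).sub iv2)
      (intervalIntegrable_energy hv h2 (V := fun x => 3 * u x ^ 2 - 1) ?_ ε) fun x _ => ?_
    · rw [h01]
      exact (continuousOn_const.mul (hu.pow 2)).sub continuousOn_const
    · nlinarith [mul_nonneg (sq_nonneg (u x)) (sq_nonneg (v x))]
  have hX0 : 0 ≤ ∫ x in (0 : ℝ)..1, v x ^ 2 :=
    intervalIntegral.integral_nonneg zero_le_one fun x _ => sq_nonneg _
  have hY0 : 0 ≤ ∫ x in (0 : ℝ)..1, v' x ^ 2 :=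
    intervalIntegral.integral_nonneg zero_le_one fun x _ => sq_nonneg _
  rw [linForm_eq, l2norm_sq, lambda0]
  set X := ∫ x in (0 : ℝ)..1, v x ^ 2
  set Y := ∫ x in (0 : ℝ)..1, v' x ^ 2
  set Q := ∫ x in (0 : ℝ)..1, (ε ^ 2 * v' x ^ 2 + (3 * u x ^ 2 - 1) * v x ^ 2)
  have hε2 : ε ^ 2 ≤ 1 := pow_le_one₀ hε.le hε1
  have hηS : η * S ^ 2 ≤ 1 / 50 * X + ε ^ 2 / 100 * Y := by
    have e1 : η * S ^ 2 ≤ ε ^ 2 / 100 * S ^ 2 := by gcongr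
    have e2 : ε ^ 2 / 100 * S ^ 2 ≤ ε ^ 2 / 100 * ((1 + 1) * X + Y / 1) := by gcongr
    nlinarith
  have hfin : 23 * M ^ 2 * S ^ 2 * X ≤ 1 / 100 * X + 23 / 1000 * (ε ^ 2 * Y) := by
    have e1 : 23 * M ^ 2 * S ^ 2 * X ≤ 23 * M ^ 2 * ((1 + t) * X + Y / t) * X := by gcongr
    have e2 : 23 * M ^ 2 * ((1 + t) * X + Y / t) * X ≤ 23 * M ^ 2 * ((1 + t) * X + Y / t) * r := by
      gcongr
    have e3 : 23 * M ^ 2 * ((1 + t) * X + Y / t) * r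
        = (23 * M ^ 2 * r + 23000 * M ^ 4 * (r ^ 2 / ε ^ 2)) * X
          + 23 / 1000 * (ε ^ 2 * Y) := by
      rw [ht]; field_simp; ring
    have e4 := mul_le_mul_of_nonneg_right hr hX0
    linarith
  -- Weights `0.95` on `hl` and `0.05` on `hcrude` suffice: they leave more than `0.75 + 0.11` of
  -- `X` and more than `0.023` of `ε²Y`.
  linarith [mul_nonneg (sq_nonneg ε) hY0]

/-- Integration by parts: the boundary term is `v'v`, which the Neumann conditions annihilate. -/
theorem ip_add_eq {ε : ℝ} {u v v' v'' : ℝ → ℝ} (hu : ContinuousOn u (Icc 0 1))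
    (hv : HasH2NeumannDeriv v v' v'') :
    ip (fun x => linOp ε u v v'' x + nonlin u v x) v = linForm ε u v v' + ip (nonlin u v) v := by
  have h01 : uIcc (0 : ℝ) 1 = Icc 0 1 := uIcc_of_le zero_le_one
  rw [← h01] at hu
  have h1 := hv.first.hasACDeriv
  have h2 := hv.second.hasACDeriv
  have hc := h1.continuousOn
  have h3 := (h2.mul h1).integral_eq_sub
  rw [hv.left, hv.right, zero_mul, zero_mul, sub_zero] at h3
  have i1 := (h2.mul h1).intervalIntegrable
  have i2 : IntervalIntegrable (fun x => -(ε ^ 2 * v' x ^ 2) - deriv f (u x) * v x ^ 2)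
      volume 0 1 := by
    simp only [deriv_f]
    exact (hv.first.intervalIntegrable_sq.const_mul _).neg.sub (ContinuousOn.intervalIntegrable
      (((continuousOn_const.mul (hu.pow 2)).sub continuousOn_const).mul (hc.pow 2)))
  have i3 : IntervalIntegrable (fun x => nonlin u v x * v x) volume 0 1 := by
    simp only [nonlin_mul_eq]
    exact ContinuousOn.intervalIntegrable ((((continuousOn_const.mul hu).mul (hc.pow 3)).neg).sub
      (hc.pow 4))
  have h4 : ip (fun x => linOp ε u v v'' x + nonlin u v x) v
      = ε ^ 2 * (∫ x in (0 : ℝ)..1, (v'' x * v x + v' x * v' x))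
        + ((∫ x in (0 : ℝ)..1, (-(ε ^ 2 * v' x ^ 2) - deriv f (u x) * v x ^ 2))
        + ∫ x in (0 : ℝ)..1, nonlin u v x * v x) := by
    rw [← intervalIntegral.integral_const_mul, ← intervalIntegral.integral_add i2 i3,
      ← intervalIntegral.integral_add (i1.const_mul _) (i2.add i3), ip]
    refine intervalIntegral.integral_congr fun x _ => ?_
    simp only [linOp]
    ring
  rw [h4, h3, mul_zero, zero_add]
  rfl

/-! ### Cells and normalization of an admissible configuration -/

/-- The interface positions indexed by natural numbers. -/
noncomputable def center {N : ℕ} (h : Fin (N + 1) → ℝ) (k : ℕ) : ℝ :=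
  if hk : k < N + 1 then h ⟨k, hk⟩ else 0

/-- The endpoints `0`, `1` and the midpoints between consecutive interfaces. -/
noncomputable def node {N : ℕ} (h : Fin (N + 1) → ℝ) (k : ℕ) : ℝ :=
  if k = 0 then 0 else if k = N + 1 then 1 else (center h (k - 1) + center h k) / 2

theorem center_val {N : ℕ} (h : Fin (N + 1) → ℝ) (i : Fin (N + 1)) : center h i = h i := by
  rw [center, dif_pos i.2]

theorem center_add_lt {N : ℕ} {κ ε : ℝ} {h : Fin (N + 1) → ℝ} (hh : h ∈ admissible N κ ε)
    {k : ℕ} (hk : k < N) : center h k + ε / ε ^ κ < center h (k + 1) := by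
  have := hh.2.2.2.2.1 ⟨k, hk⟩
  rw [← center_val h, ← center_val h] at this
  simp only [Fin.val_succ, Fin.val_castSucc] at this
  linarith

/-- Half of each gap lies on either side of a midpoint. At the walls the reflected interfaces `-h₁`
and `2 - h_{N+1}` make the gap twice the distance to the wall, so the same half gap appears. -/
theorem isCellPartition_node {N : ℕ} {κ ε : ℝ} (hε : 0 < ε) {h : Fin (N + 1) → ℝ}
    (hh : h ∈ admissible N κ ε) : IsCellPartition N (ε / ε ^ κ / 2) (node h) (center h) where
  pos := by positivity
  zero := by simp [node]
  one := by simp [node]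
  left k hk := by
    rcases k with _ | k
    · have h1 := hh.2.2.2.1
      have h2 := center_val h 0
      simp only [Fin.val_zero] at h2
      rw [node, if_pos rfl, h2]
      linarith
    · have := center_add_lt hh (k := k) (by omega)
      rw [node, if_neg (by omega), if_neg (by omega), Nat.add_sub_cancel]
      linarith
  right k hk := by
    rcases hk.eq_or_lt with rfl | hk
    · have h1 := hh.2.2.2.2.2
      have h2 := center_val h (Fin.last k)
      simp only [Fin.val_last] at h2
      rw [node, if_neg (by omega), if_pos rfl, h2]
      linarith
    · have := center_add_lt hh hk
      rw [node, if_neg (by omega), if_neg (by omega), Nat.add_sub_cancel]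
      linarith

theorem isOpen_admissible (N : ℕ) (κ ε : ℝ) : IsOpen (admissible N κ ε) := by
  have h1 : IsOpen {h : Fin (N + 1) → ℝ | StrictMono h} := by
    simp only [Fin.strictMono_iff_lt_succ, ofPred_forall]
    exact isOpen_iInter_of_finite fun i =>
      isOpen_lt (continuous_apply _) (continuous_apply _)
  have h2 : IsOpen {h : Fin (N + 1) → ℝ | ∀ j : Fin N, ε / ε ^ κ < h j.succ - h j.castSucc} := by
    simp only [ofPred_forall]
    exact isOpen_iInter_of_finite fun i =>
      isOpen_lt continuous_const ((continuous_apply _).sub (continuous_apply _))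
  refine IsOpen.inter (isOpen_lt continuous_const (continuous_apply _)) (IsOpen.inter h1
    (IsOpen.inter (isOpen_lt (continuous_apply _) continuous_const) (IsOpen.inter
    (isOpen_lt continuous_const ((continuous_apply _).sub (continuous_apply _).neg))
    (IsOpen.inter h2 (isOpen_lt continuous_const
      ((continuous_const.sub (continuous_apply _)).sub (continuous_apply _)))))))

section Normalization

variable {N : ℕ} {A : Set (Fin (N + 1) → ℝ)} {b : (Fin (N + 1) → ℝ) → ℝ → ℝ}
  {h : Fin (N + 1) → ℝ}

theorem continuousOn_slice
    (hb : ContDiffOn ℝ ∞ (fun p : (Fin (N + 1) → ℝ) × ℝ => b p.1 p.2) (A ×ˢ Icc (0 : ℝ) 1))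
    (hh : h ∈ A) : ContinuousOn (b h) (Icc 0 1) :=
  hb.continuousOn.comp (f := fun x : ℝ => (h, x)) (by fun_prop) fun _ hx => ⟨hh, hx⟩

/-- The set of admissible pairs is not open at `x = 0, 1`, but only the `h` directions are
differentiated and `A` is open. The derivative within the set therefore gives a genuine partial
derivative even at the endpoints. -/
theorem exists_partial_deriv (hA : IsOpen A)
    (hb : ContDiffOn ℝ ∞ (fun p : (Fin (N + 1) → ℝ) × ℝ => b p.1 p.2) (A ×ˢ Icc (0 : ℝ) 1))
    {k B : ℝ} (hB : ∀ p ∈ A ×ˢ Icc (0 : ℝ) 1, ‖iteratedFDerivWithin ℝ 1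
      (fun p : (Fin (N + 1) → ℝ) × ℝ => b p.1 p.2 - k) (A ×ˢ Icc (0 : ℝ) 1) p‖ ≤ B)
    (hh : h ∈ A) (i : Fin (N + 1)) :
    ∃ g : ℝ → ℝ, ContinuousOn g (Icc 0 1) ∧ ∀ x ∈ Icc (0 : ℝ) 1, |g x| ≤ B ∧
      HasDerivAt (fun s => b (Function.update h i s) x) (g x) (h i) := by
  set F : (Fin (N + 1) → ℝ) × ℝ → ℝ := fun p => b p.1 p.2 with hF
  set Ω := A ×ˢ Icc (0 : ℝ) 1 with hΩ
  have hU : UniqueDiffOn ℝ Ω := hA.uniqueDiffOn.prod (uniqueDiffOn_Icc zero_lt_one)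
  set e : (Fin (N + 1) → ℝ) × ℝ := (Pi.single i 1, 0) with he
  have hmem : ∀ x ∈ Icc (0 : ℝ) 1, (h, x) ∈ Ω := fun x hx => ⟨hh, hx⟩
  refine ⟨fun x => fderivWithin ℝ F Ω (h, x) e, ?_, fun x hx => ⟨?_, ?_⟩⟩
  · have h1 : ContinuousOn (fderivWithin ℝ F Ω) Ω :=
      hb.continuousOn_fderivWithin hU (by simp)
    exact (h1.comp (f := fun x : ℝ => (h, x)) (by fun_prop) hmem).clm_apply continuousOn_const
  · have h1 := hB (h, x) (hmem x hx)
    rw [norm_iteratedFDerivWithin_one _ (hU _ (hmem x hx)), fderivWithin_sub_const] at h1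
    have h2 := (fderivWithin ℝ F Ω (h, x)).le_of_opNorm_le h1 e
    have h3 : ‖e‖ ≤ 1 := by
      rw [he, Prod.norm_mk, norm_zero, Pi.norm_single]
      simp
    rw [← Real.norm_eq_abs]
    exact h2.trans (mul_le_of_le_one_right ((norm_nonneg _).trans h1) h3)
  · have h1 : HasFDerivWithinAt F (fderivWithin ℝ F Ω (h, x)) Ω (h, x) :=
      ((hb.differentiableOn (by simp)) _ (hmem x hx)).hasFDerivWithinAt
    have h2 : HasDerivAt (fun s : ℝ => (Function.update h i s, x)) e (h i) := by
      refine HasDerivAt.prodMk ?_ (hasDerivAt_const _ _)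
      exact hasDerivAt_update h i (h i)
    have h3 : ∀ᶠ s in 𝓝 (h i), (Function.update h i s, x) ∈ Ω := by
      have h4 : Tendsto (fun s : ℝ => Function.update h i s) (𝓝 (h i)) (𝓝 h) := by
        have : Continuous fun s : ℝ => Function.update h i s := by fun_prop
        simpa using this.tendsto (h i)
      filter_upwards [h4.eventually (hA.mem_nhds hh)] with s hs using ⟨hs, hx⟩
    have h5 : HasFDerivWithinAt F (fderivWithin ℝ F Ω (h, x)) Ω
        ((fun s : ℝ => (Function.update h i s, x)) (h i)) := by simpa using h1
    have h6 := h5.comp_hasDerivWithinAt (s := {s | (Function.update h i s, x) ∈ Ω}) (h i)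
      h2.hasDerivWithinAt fun s hs => hs
    exact h6.hasDerivAt h3

end Normalization

/-! ### The multi-kink profile and its tangent vectors -/

section Profile

variable {N : ℕ} {β : ℝ → (Fin (N + 1) → ℝ) → ℝ → ℝ} {ε : ℝ} {h : Fin (N + 1) → ℝ}

theorem profile_eq (x : ℝ) : profile β ε h x
    = ∑ k ∈ Finset.range (N + 1), (-1 : ℝ) ^ k * kink ε (center h k) x + β ε h x := by
  rw [profile, ← Fin.sum_univ_eq_sum_range (fun k => (-1 : ℝ) ^ k * kink ε (center h k) x)]
  simp only [center_val, kink]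

theorem continuousOn_profile (hβ : ContinuousOn (β ε h) (Icc 0 1)) :
    ContinuousOn (profile β ε h) (Icc 0 1) := by
  have : Continuous fun x => ∑ j : Fin (N + 1), (-1 : ℝ) ^ (j : ℕ) * U ((x - h j) / ε) :=
    continuous_finsetSum _ fun j _ => continuous_const.mul (continuous_kink ε (h j))
  exact this.continuousOn.add hβ

theorem tangent_eq {i : Fin (N + 1)} {x g : ℝ}
    (hg : HasDerivAt (fun s => β ε (Function.update h i s) x) g (h i)) :
    tangent β ε h i x = -(-1) ^ (i : ℕ) * (mode ε (h i) x / (√2 * ε)) + g := by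
  have h1 : ∀ j ∈ (Finset.univ : Finset (Fin (N + 1))), HasDerivAt
      (fun s => (-1 : ℝ) ^ (j : ℕ) * U ((x - Function.update h i s j) / ε))
      (if j = i then -(-1) ^ (i : ℕ) * (mode ε (h i) x / (√2 * ε)) else 0) (h i) := fun j _ => by
    split_ifs with hj
    · subst hj
      simp only [Function.update_self]
      have h2 : HasDerivAt (fun s : ℝ => (x - s) / ε) (-1 / ε) (h j) :=
        ((hasDerivAt_id (h j)).const_sub x).div_const ε
      refine (((hasDerivAt_U _).comp (h j) h2).const_mul ((-1 : ℝ) ^ (j : ℕ))).congr_deriv ?_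
      simp only [mode, kink]
      rw [← div_div]
      ring
    · simp only [Function.update_of_ne hj]
      exact hasDerivAt_const _ _
  have h3 := (HasDerivAt.fun_sum h1).add hg
  rw [Finset.sum_ite_eq' Finset.univ i, if_pos (Finset.mem_univ i)] at h3
  exact h3.deriv

/-- Orthogonality to the tangent vectors of the profile gives near orthogonality to the
translation modes of the single kinks. -/
theorem abs_integral_mode_le {v g : ℝ → ℝ} {i : Fin (N + 1)} {S B : ℝ} (hε : 0 < ε) (hε1 : ε ≤ 1)
    (hv : ContinuousOn v (Icc 0 1)) (hS : ∀ x ∈ Icc (0 : ℝ) 1, |v x| ≤ S)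
    (hgc : ContinuousOn g (Icc 0 1))
    (hg : ∀ x ∈ Icc (0 : ℝ) 1, |g x| ≤ B ∧
      HasDerivAt (fun s => β ε (Function.update h i s) x) (g x) (h i))
    (horth : ip v (tangent β ε h i) = 0) :
    |∫ x in (0 : ℝ)..1, v x * mode ε (h i) x| ≤ 2 * S * B := by
  have h01 : uIcc (0 : ℝ) 1 = Icc 0 1 := uIcc_of_le zero_le_one
  rw [← h01] at hv hgc
  have h0 : (0 : ℝ) ∈ Icc (0 : ℝ) 1 := ⟨le_rfl, zero_le_one⟩
  have hS0 : 0 ≤ S := (abs_nonneg _).trans (hS 0 h0)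
  have hB0 : 0 ≤ B := (abs_nonneg _).trans (hg 0 h0).1
  have h1 : ip v (tangent β ε h i) = -(-1) ^ (i : ℕ) / (√2 * ε)
      * (∫ x in (0 : ℝ)..1, v x * mode ε (h i) x) + ∫ x in (0 : ℝ)..1, v x * g x := by
    have i1 : IntervalIntegrable (fun x => v x * mode ε (h i) x) volume 0 1 :=
      (hv.mul (continuous_mode ε (h i)).continuousOn).intervalIntegrable
    have i2 : IntervalIntegrable (fun x => v x * g x) volume 0 1 :=
      (hv.mul hgc).intervalIntegrable
    rw [← intervalIntegral.integral_const_mul,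
      ← intervalIntegral.integral_add (i1.const_mul _) i2, ip]
    refine intervalIntegral.integral_congr fun x hx => ?_
    rw [h01] at hx
    simp only [tangent_eq (hg x hx).2]
    ring
  have h2 : |∫ x in (0 : ℝ)..1, v x * g x| ≤ S * B := by
    have := intervalIntegral.norm_integral_le_of_norm_le_const (a := 0) (b := 1)
      (f := fun x => v x * g x) (C := S * B) fun x hx => by
        rw [uIoc_of_le zero_le_one] at hx
        have hx' := Ioc_subset_Icc_self hx
        rw [Real.norm_eq_abs, abs_mul]
        exact mul_le_mul (hS x hx') (hg x hx').1 (abs_nonneg _) hS0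
    simpa using this
  rw [horth] at h1
  have h22 : √2 * √2 = 2 := Real.mul_self_sqrt (by norm_num)
  have h3 : √2 ≤ 2 := by nlinarith [Real.one_le_sqrt.2 (by norm_num : (1 : ℝ) ≤ 2)]
  set I := ∫ x in (0 : ℝ)..1, v x * mode ε (h i) x
  set J := ∫ x in (0 : ℝ)..1, v x * g x
  have h4 : (-1 : ℝ) ^ (i : ℕ) * I = √2 * ε * J := by
    have : J = (-1 : ℝ) ^ (i : ℕ) / (√2 * ε) * I := by linear_combination -h1
    rw [this]
    field_simp
  have h5 : |I| = √2 * ε * |J| := by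
    have := congrArg abs h4
    rwa [abs_mul, abs_pow, abs_neg, abs_one, one_pow, one_mul, abs_mul,
      abs_of_pos (show 0 < √2 * ε by positivity)] at this
  rw [h5]
  calc √2 * ε * |J| ≤ 2 * 1 * (S * B) := by gcongr
    _ = _ := by ring

end Profile

/-! ### Smallness as `ε → 0` and conclusion -/

/-- In the variable `y = ε^(-κ) → ∞` the factor `ε^(-2)` is the power `y^(2/κ)`, beaten by
`exp(-cy)`. -/
theorem eventually_exp_le {κ : ℝ} (hκ : 0 < κ) {C c η : ℝ} (hc : 0 < c) (hη : 0 < η) :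
    ∀ᶠ ε in 𝓝[>] (0 : ℝ), C * Real.exp (-(c / ε ^ κ)) ≤ η * ε ^ 2 := by
  have h1 : Tendsto (fun ε : ℝ => (ε ^ κ)⁻¹) (𝓝[>] 0) atTop := by
    refine tendsto_inv_nhdsGT_zero.comp (tendsto_nhdsWithin_iff.2 ⟨?_, ?_⟩)
    · have := (Real.continuousAt_rpow_const 0 κ (Or.inr hκ.le)).tendsto
      rw [Real.zero_rpow hκ.ne'] at this
      exact this.mono_left nhdsWithin_le_nhds
    · filter_upwards [self_mem_nhdsWithin] with ε hε using Real.rpow_pos_of_pos hε κ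
  have h2 := ((tendsto_rpow_mul_exp_neg_mul_atTop_nhds_zero (2 / κ) c hc).comp h1).const_mul C
  rw [mul_zero] at h2
  filter_upwards [h2.eventually (gt_mem_nhds hη), self_mem_nhdsWithin] with ε hlt hε
  have hε : 0 < ε := hε
  simp only [Function.comp_apply] at hlt
  have h3 : ((ε ^ κ)⁻¹) ^ (2 / κ) = (ε ^ 2)⁻¹ := by
    rw [Real.inv_rpow (by positivity), ← Real.rpow_mul hε.le, mul_div_cancel₀ _ hκ.ne']
    norm_cast
  rw [h3, neg_mul, ← div_eq_mul_inv] at hlt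
  have h4 : C * ((ε ^ 2)⁻¹ * Real.exp (-(c / ε ^ κ))) * ε ^ 2
      = C * Real.exp (-(c / ε ^ κ)) := by field_simp
  rw [← h4]
  exact mul_le_mul_of_nonneg_right hlt.le (by positivity)

/-- The exponent `1/2` is the threshold: with `r = ε^(1+2m)`, `r²/ε² = ε^(4m)` tends to zero
precisely because `m > 0`. -/
theorem eventually_radius_le {m : ℝ} (hm : 0 < m) (M : ℝ) :
    ∀ᶠ ε in 𝓝[>] (0 : ℝ), 23 * M ^ 2 * (ε ^ (1 / 2 + m)) ^ 2
      + 23000 * M ^ 4 * (((ε ^ (1 / 2 + m)) ^ 2) ^ 2 / ε ^ 2) ≤ 1 / 100 := by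
  have h1 : ∀ s : ℝ, 0 < s → Tendsto (fun ε : ℝ => ε ^ s) (𝓝[>] 0) (𝓝 0) := fun s hs => by
    have := (Real.continuousAt_rpow_const 0 s (Or.inr hs.le)).tendsto
    rw [Real.zero_rpow hs.ne'] at this
    exact this.mono_left nhdsWithin_le_nhds
  have h2 := (((h1 (1 / 2 + m) (by positivity)).pow 2).const_mul (23 * M ^ 2)).add
    (((h1 m hm).pow 4).const_mul (23000 * M ^ 4))
  norm_num at h2
  filter_upwards [h2.eventually (ge_mem_nhds (show (0 : ℝ) < 1 / 100 by norm_num)),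
    self_mem_nhdsWithin] with ε hle hε
  have hε : 0 < ε := hε
  have h3 : ((ε ^ (1 / 2 + m)) ^ 2) ^ 2 / ε ^ 2 = (ε ^ m) ^ 4 := by
    rw [Real.rpow_add hε, ← Real.sqrt_eq_rpow, mul_pow, Real.sq_sqrt hε.le]
    field_simp
  rw [h3]
  norm_num at hle ⊢
  exact hle

theorem abs_profile_le {N : ℕ} {β : ℝ → (Fin (N + 1) → ℝ) → ℝ → ℝ} {ε B x : ℝ}
    {h : Fin (N + 1) → ℝ} (hB : |β ε h x - ((-1 : ℝ) ^ N - 1) / 2| ≤ B) :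
    |profile β ε h x| ≤ N + 2 + B := by
  have h1 : |∑ k ∈ Finset.range (N + 1), (-1 : ℝ) ^ k * kink ε (center h k) x| ≤ N + 1 := by
    refine (Finset.abs_sum_le_sum_abs _ _).trans ((Finset.sum_le_card_nsmul _ _ 1 ?_).trans ?_)
    · intro k _
      rw [abs_mul, abs_pow, abs_neg, abs_one, one_pow, one_mul]
      exact (abs_U_lt_one _).le
    · simp
  have h2 : |((-1 : ℝ) ^ N - 1) / 2| ≤ 1 := by
    rcases neg_one_pow_eq_or ℝ N with h | h <;> rw [h] <;> norm_num
  rw [profile_eq]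
  rw [abs_le] at *
  constructor <;> linarith [h1.1, h1.2, h2.1, h2.2, hB.1, hB.2]

/-- Coercivity of the linearized energy at the multi-kink profile on the complement of its
tangent vectors. -/
theorem profile_energy_lower_bound {N : ℕ} {κ ε B₀ B₁ S : ℝ}
    {β : ℝ → (Fin (N + 1) → ℝ) → ℝ → ℝ} {h : Fin (N + 1) → ℝ} {v v' : ℝ → ℝ}
    (hε : 0 < ε) (hε1 : ε ≤ 1)
    (hβ : ContDiffOn ℝ ∞ (fun p : (Fin (N + 1) → ℝ) × ℝ => β ε p.1 p.2)
      (admissible N κ ε ×ˢ Icc (0 : ℝ) 1))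
    (hB₀ : ∀ x ∈ Icc (0 : ℝ) 1, |β ε h x - ((-1 : ℝ) ^ N - 1) / 2| ≤ B₀)
    (hB₁ : ∀ p ∈ admissible N κ ε ×ˢ Icc (0 : ℝ) 1, ‖iteratedFDerivWithin ℝ 1
      (fun p : (Fin (N + 1) → ℝ) × ℝ => β ε p.1 p.2 - ((-1 : ℝ) ^ N - 1) / 2)
      (admissible N κ ε ×ˢ Icc (0 : ℝ) 1) p‖ ≤ B₁)
    (hh : h ∈ admissible N κ ε) (hv : HasACDeriv v v' 0 1)
    (h2 : IntervalIntegrable (fun x => v' x ^ 2) volume 0 1)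
    (horth : ∀ i, ip v (tangent β ε h i) = 0) (hS : ∀ x ∈ Icc (0 : ℝ) 1, |v x| ≤ S) :
    (∫ x in (0 : ℝ)..1, v x ^ 2)
        - (N + 1) * (14 * B₀ + 4 * B₁ + 72 * (N + 1) * Real.exp (-(1 / 2 / ε ^ κ))) * S ^ 2
      ≤ ∫ x in (0 : ℝ)..1, (ε ^ 2 * v' x ^ 2 + (3 * profile β ε h x ^ 2 - 1) * v x ^ 2) := by
  have H := isCellPartition_node hε hh
  have hvc : ContinuousOn v (Icc 0 1) := by
    simpa only [uIcc_of_le (zero_le_one' ℝ)] using hv.continuousOn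
  have hd : ε / ε ^ κ / 2 / ε = 1 / 2 / ε ^ κ := by field_simp
  set E := Real.exp (-(1 / 2 / ε ^ κ)) with hE
  have hE0 : 0 < E := Real.exp_pos _
  have hB0 : 0 ≤ B₀ := (abs_nonneg _).trans (hB₀ 0 ⟨le_rfl, zero_le_one⟩)
  have hN : (0 : ℝ) ≤ N := Nat.cast_nonneg N
  have hNE : 0 ≤ N * E := by positivity
  have hmode : ∀ k ≤ N, ∀ x, (x ≤ center h k - ε / ε ^ κ / 2 ∨ center h k + ε / ε ^ κ / 2 ≤ x) →
      mode ε (center h k) x ≤ B₀ + 4 * (N + 1) * E := fun k hk x hx => by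
    have := H.mode_le hε hx
    rw [hd] at this
    linarith
  -- `δ` must bound both the distance to the single kink, `B₀ + 2(N+1)E`, and the mode at the nodes,
  -- `4E`. Then `14δ` and `2Sτ` together contribute at most `72(N+1)E`.
  have key := H.energy_lower_bound (δ := B₀ + 4 * (N + 1) * E) (τ := 2 * S * B₁ + 8 * E * S)
    hε hε1 hv h2 (continuousOn_profile (continuousOn_slice hβ hh)) hS ?_ ?_ ?_ ?_
  · have hS2 : 0 ≤ E * S ^ 2 := by positivity
    have hS3 : 0 ≤ N * (E * S ^ 2) := by positivity
    nlinarith [mul_nonneg hN hS2, mul_nonneg hN hS3]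
  · intro k hk x hx
    have h3 := H.abs_sum_sub_kink_le hε hk hx
    have h4 := hB₀ x (H.cell_subset hk hx)
    rw [hd] at h3
    rw [profile_eq]
    rw [abs_le] at *
    constructor <;> linarith [h3.1, h3.2, h4.1, h4.2]
  · exact fun k hk => hmode k hk _ (Or.inl (by linarith [H.left k hk]))
  · exact fun k hk => hmode k hk _ (Or.inr (H.right k hk))
  · intro k hk
    have h3 := H.abs_integral_cell_le hε hvc hS hk
    obtain ⟨g, hgc, hg⟩ := exists_partial_deriv (isOpen_admissible N κ ε) hβ hB₁ hh
      ⟨k, Nat.lt_succ_of_le hk⟩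
    have h4 := abs_integral_mode_le hε hε1 hvc hS hgc hg (horth _)
    rw [← center_val h] at h4
    rw [hd] at h3
    linarith

end AllenCahn

theorem theorem6p2 (N : ℕ) (κ : ℝ) (hκ₀ : 0 < κ) (hκ₁ : κ < 1)
    (β : ℝ → (Fin (N + 1) → ℝ) → ℝ → ℝ) (hβ : AllenCahn.IsNormalization N κ β)
    (m : ℝ) (hm : 0 < m) :
    ∃ ε₀ > 0, ∀ ε : ℝ, 0 < ε → ε < ε₀ →
      ∀ h ∈ AllenCahn.admissible N κ ε, ∀ v v' : ℝ → ℝ, AllenCahn.HasH1Deriv v v' →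
        (∀ i, AllenCahn.ip v (AllenCahn.tangent β ε h i) = 0) →
        AllenCahn.l2norm v < ε ^ (1 / 2 + m) →
        AllenCahn.linForm ε (AllenCahn.profile β ε h) v v'
            + AllenCahn.ip (AllenCahn.nonlin (AllenCahn.profile β ε h) v) v
          ≤ -(1 / 2) * AllenCahn.lambda0 * AllenCahn.l2norm v ^ 2 ∧
        ∀ v'' : ℝ → ℝ, AllenCahn.HasH2NeumannDeriv v v' v'' →
          AllenCahn.ip (fun x => AllenCahn.linOp ε (AllenCahn.profile β ε h) v v'' x
              + AllenCahn.nonlin (AllenCahn.profile β ε h) v x) v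
            ≤ -(1 / 2) * AllenCahn.lambda0 * AllenCahn.l2norm v ^ 2 := by
  open AllenCahn in
  obtain ⟨C₀, hC₀, c₀, hc₀, hsmall₀⟩ := hβ.small 0
  obtain ⟨C₁, hC₁, c₁, hc₁, hsmall₁⟩ := hβ.small 1
  have hN : (0 : ℝ) ≤ N := Nat.cast_nonneg N
  -- Three errors of at most `ε²/300` add up to the `ε²/100` allowed by `energy_estimate`; `N + 3`
  -- bounds the profile once the error in `β` is at most `1`.
  have ev := (eventually_exp_le hκ₀ (C := (N + 1) * 14 * C₀) hc₀
    (show (0 : ℝ) < 1 / 300 by norm_num)).and <|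
    (eventually_exp_le hκ₀ (C := (N + 1) * 4 * C₁) hc₁
    (show (0 : ℝ) < 1 / 300 by norm_num)).and <|
    (eventually_exp_le hκ₀ (C := (N + 1) * (72 * (N + 1))) (show (0 : ℝ) < 1 / 2 by norm_num)
    (show (0 : ℝ) < 1 / 300 by norm_num)).and <|
    (eventually_radius_le hm ((N : ℝ) + 3)).and <|
    (hβ.smooth.and (hsmall₀.and hsmall₁))
  obtain ⟨ε₀, hε₀, hsub⟩ := mem_nhdsGT_iff_exists_Ioo_subset.1 ev
  refine ⟨min ε₀ 1, lt_min hε₀ one_pos, fun ε hε hlt h hh v v' hv horth hnorm => ?_⟩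
  obtain ⟨he₀, he₁, he₂, hrad, hsmooth, hs₀, hs₁⟩ := hsub ⟨hε, hlt.trans_le (min_le_left _ _)⟩
  have hε1 : ε ≤ 1 := (hlt.trans_le (min_le_right _ _)).le
  have hB₀ : ∀ x ∈ Icc (0 : ℝ) 1, |β ε h x - ((-1 : ℝ) ^ N - 1) / 2|
      ≤ C₀ * Real.exp (-(c₀ / ε ^ κ)) := fun x hx => by
    have := hs₀ (h, x) ⟨hh, hx⟩
    rwa [norm_iteratedFDerivWithin_zero, Real.norm_eq_abs] at this
  have hac := hv.hasACDeriv
  have hu := continuousOn_profile (continuousOn_slice hsmooth hh)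
  have hB1 : C₀ * Real.exp (-(c₀ / ε ^ κ)) ≤ 1 := by
    have h1 : 0 ≤ C₀ * Real.exp (-(c₀ / ε ^ κ)) := by positivity
    have h2 : ε ^ 2 ≤ 1 := pow_le_one₀ hε.le hε1
    nlinarith [mul_nonneg hN h1]
  have hmain := energy_estimate (r := (ε ^ (1 / 2 + m)) ^ 2) (M := N + 3) hε hε1 hac
    hv.intervalIntegrable_sq hu (by positivity)
    (fun x hx => (abs_profile_le (hB₀ x hx)).trans (by linarith)) (by linarith) (by positivity)
    hrad (by
      rw [← l2norm_sq]
      exact pow_le_pow_left₀ (Real.sqrt_nonneg _) hnorm.le 2)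
    fun S hS => profile_energy_lower_bound hε hε1 hsmooth hB₀ hs₁ hh hac
      hv.intervalIntegrable_sq horth hS
  exact ⟨hmain, fun v'' hv2 => (ip_add_eq hu hv2).trans_le hmain⟩
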